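/- Let $\mathbb T$ be a closed subset of $\mathbb R$ with minimum $a$ and maximum $b$, $a<b$. Let $\sigma(t)=\inf\{s\in\mathbb T:s>t\}$ and $\rho(t)=\sup\{s\in\mathbb T:s<t\}$ (with $\inf\emptyset=b$, $\sup\emptyset=a$), $\mu(t)=\sigma(t)-t$, $f^\sigma=f\circ\sigma$, $\mathbb T^k=\mathbb T\setminus(\rho(b),b]$, and let $f^\Delta$ denote the delta derivative. A function is rd-continuous if it is continuous at right-dense points ($\sigma(t)=t$) and has a left-sided limit at left-dense points ($\rho(t)=t$); $C_{\mathrm{rd}}$ is the set of these functions, and $C^1_{\mathrm{rd}}$ consists of the $y$ that are delta differentiable on $\mathbb T^k$ with $y^\Delta$ rd-continuous on $\mathbb T^k$. Put $\int_a^b f\,\Delta t=F(b)-F(a)$ where $F^\Delta=f$ on $\mathbb T^k$. Let $L:\mathbb T\times\mathbb R^n\times\mathbb R^m\to\mathbb R$ and $\varphi:\mathbb T\times\mathbb R^n\times\mathbb R^m\to\mathbb R^n$ be $C^1$ in $(y,u)$ for each $t\in\mathbb T$, and assume that $L$, $\varphi$ and their first derivatives in $(y,u)$ are rd-continuous, where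 $f(t,z)$ is called rd-continuous if it is jointly continuous (relative to $\mathbb T$) at $(t,z)$ for every right-dense $t$ and every $z$, and has a limit as $(s,w)\to(t,z)$, $s<t$, for every left-dense $t$ and every $z$. Consider the Lagrange problem $$J[y,u]=\int_a^b L(t,y(t),u(t))\,\Delta t\to\min,\qquad y^\Delta(t)=\varphi(t,y(t),u(t))\ (t\in\mathbb T^k),\qquad (y(a)=y_a),\ (y(b)=y_b),$$ over $y\in C^1_{\mathrm{rd}}$, $u\in C_{\mathrm{rd}}$, where each of the two boundary conditions may be present or absent. Let $(y_*,u_*)$ be a weak local minimizer: it is admissible and there is $\delta>0$ such that $J[y_*,u_*]\le J[y,u]$ for all admissible $(y,u)$ with $\|y-y_*\|_\infty+\|(y-y_*)^\Delta\|_\infty+\|u-u_*\|_\infty<\delta$, where $\|f\|_\infty=\sup_{t\in\mathbb T^k}|f(t)|$. Then there exist a constant $\psi_0\ge 0$ and a function $\psi:\mathbb T\to\mathbb R^n$, delta differentiable on $\mathbb T^k$, with $\psi_0$ and $\psi^\sigma|_{\mathbb T^k}$ not both zero (in particular $(\psi_0,\psi)\ne 0$), such that $(y_*,u_*,\psi_0,\psi)$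 satisfies the Euler–Lagrange equations of the augmented functional $$J^*[y,u,\psi]=\int_a^b L^*\bigl(t,y(t),u(t),\psi^\sigma(t),y^\Delta(t)\bigr)\Delta t=\int_a^b\bigl[\psi_0L(t,y(t),u(t))+\psi^\sigma(t)\cdot(\varphi(t,y(t),u(t))-y^\Delta(t))\bigr]\Delta t,$$ that is, for all $t\in\mathbb T^k$, $$\bigl(L^*_{y^\Delta}-\mu L^*_y\bigr)^\Delta=L^*_y,\qquad \bigl(-\mu L^*_u\bigr)^\Delta=L^*_u,\qquad L^*_u=0,\qquad L^*_{\psi^\sigma}=0,$$ the partial derivatives being evaluated along $(t,y_*(t),u_*(t),\psi^\sigma(t),y_*^\Delta(t))$. (If $b$ is left-scattered, $\mu L^*_y$ and $\mu L^*_u$ are zero and $L^*_{y^\Delta}=-\psi(b)$ at $t=b$.) -/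

import Mathlib

open Set Filter Topology
open scoped ENNReal

noncomputable section

namespace TimeScale

/-- `T` is a time scale of the form `[a, b] ∩ T₀` (`T₀` closed) containing both `a < b`. -/
structure IsTimeScaleOn (T : Set ℝ) (a b : ℝ) : Prop where
  isClosed : IsClosed T
  isLeast : IsLeast T a
  isGreatest : IsGreatest T b
  lt : a < b

open Classical in
/-- Forward jump operator, with `inf ∅ = sup T`. -/
def sigma (T : Set ℝ) (t : ℝ) : ℝ :=
  if (T ∩ Ioi t).Nonempty then sInf (T ∩ Ioi t) else sSup T

open Classical in
/-- Backward jump operator, with `sup ∅ = inf T`. -/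
def rho (T : Set ℝ) (t : ℝ) : ℝ :=
  if (T ∩ Iio t).Nonempty then sSup (T ∩ Iio t) else sInf T

/-- Graininess. -/
def mu (T : Set ℝ) (t : ℝ) : ℝ := sigma T t - t

/-- `T^k = T \ (ρ(b), b]`, where `b` is the maximum of `T`. -/
def kappa (T : Set ℝ) (b : ℝ) : Set ℝ := T \ Ioc (rho T b) b

section Calculus

variable {E : Type*} [NormedAddCommGroup E] [NormedSpace ℝ E]

/-- `f' = f^Δ(t)`: the delta derivative on the time scale `T`.
Only the values of `f` on `T` matter. -/
def HasDeltaDeriv (T : Set ℝ) (f : ℝ → E) (f' : E) (t : ℝ) : Prop :=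
  ∀ ε > 0, ∃ δ > 0, ∀ s ∈ T, |s - t| < δ →
    ‖f (sigma T t) - f s - (sigma T t - s) • f'‖ ≤ ε * |sigma T t - s|

def DeltaDifferentiableAt (T : Set ℝ) (f : ℝ → E) (t : ℝ) : Prop :=
  ∃ f' : E, HasDeltaDeriv T f f' t

open Classical in
/-- The delta derivative as a function; it is unique at the points of `T^k`, and set to `0`
where it does not exist. -/
def deltaDeriv (T : Set ℝ) (f : ℝ → E) (t : ℝ) : E :=
  if h : DeltaDifferentiableAt T f t then h.choose else 0

/-- `f : S → E` is rd-continuous, for a part `S` of the time scale `T` (here `S` is `T` or `T^k`):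
continuous at right-dense points, with a left-sided limit at left-dense points. -/
def RdContinuousOn (T S : Set ℝ) (f : ℝ → E) : Prop :=
  ∀ t ∈ S, (sigma T t = t → ContinuousWithinAt f S t) ∧
    (rho T t = t → ∃ l : E, Tendsto f (𝓝[S ∩ Iio t] t) (𝓝 l))

/-- The class `C¹_rd` of functions on `T`, with `b = max T`. -/
def IsC1rd (T : Set ℝ) (b : ℝ) (f : ℝ → E) : Prop :=
  (∀ t ∈ kappa T b, DeltaDifferentiableAt T f t) ∧
    RdContinuousOn T (kappa T b) (deltaDeriv T f)

/-- A function `f(t, z)` of `t ∈ T` and a parameter `z` is rd-continuous: continuous at `(t, z)`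
if `t` is right-dense, with a limit as `(s, w) → (t, z)`, `s < t`, if `t` is left-dense.
This makes `t ↦ f(t, z(t))` rd-continuous for every rd-continuous `z`. -/
def RdContinuousFamily {Z : Type*} [TopologicalSpace Z] (T : Set ℝ) (f : ℝ → Z → E) : Prop :=
  ∀ t ∈ T, ∀ z : Z,
    (sigma T t = t →
      Tendsto (fun p : ℝ × Z => f p.1 p.2) (𝓝[T] t ×ˢ 𝓝 z) (𝓝 (f t z))) ∧
    (rho T t = t →
      ∃ l : E, Tendsto (fun p : ℝ × Z => f p.1 p.2) (𝓝[T ∩ Iio t] t ×ˢ 𝓝 z) (𝓝 l))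

/-- `F` is an antiderivative of `f` on the time scale `T`, with `b = max T`. -/
def IsAntiderivative (T : Set ℝ) (b : ℝ) (F f : ℝ → E) : Prop :=
  ∀ t ∈ kappa T b, HasDeltaDeriv T F (f t) t

open Classical in
/-- The delta integral `∫_a^b f(t) Δt = F(b) - F(a)` over `T`, where `a = min T`, `b = max T`
and `F^Δ = f` on `T^k` (an antiderivative exists if `f` is rd-continuous, and the value does not
depend on its choice; the integral is set to `0` if there is no antiderivative). -/
def deltaIntegral (T : Set ℝ) (a b : ℝ) (f : ℝ → E) : E :=
  if h : ∃ F : ℝ → E, IsAntiderivative T b F f then h.choose b - h.choose a else 0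

/-- `‖f‖_∞ = sup_{t ∈ T^k} |f(t)|`, in `[0, ∞]`. -/
def supNorm (T : Set ℝ) (b : ℝ) (f : ℝ → E) : ℝ≥0∞ := ⨆ t ∈ kappa T b, ‖f t‖ₑ

end Calculus

/-- `ℝ^n` with the Euclidean norm. -/
abbrev Vec (n : ℕ) : Type := EuclideanSpace ℝ (Fin n)

variable {n m : ℕ}

/-- Standing regularity of `f(t, y, u)` (used for the Lagrangian `L` and for `φ`): of class `C¹` in
`(y, u)` for each `t ∈ T`, the function and its first derivative in `(y, u)` being rd-continuous. -/
structure IsRegularData {F : Type*} [NormedAddCommGroup F] [NormedSpace ℝ F] (T : Set ℝ)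
    (f : ℝ → Vec n → Vec m → F) : Prop where
  contDiff : ∀ t ∈ T, ContDiff ℝ 1 (fun z : Vec n × Vec m => f t z.1 z.2)
  rdContinuous : RdContinuousFamily T (fun t (z : Vec n × Vec m) => f t z.1 z.2)
  rdContinuous_fderiv : RdContinuousFamily T
    (fun t => fderiv ℝ (fun z : Vec n × Vec m => f t z.1 z.2))

/-- `J[y, u] = ∫_a^b L(t, y(t), u(t)) Δt`. -/
def cost (T : Set ℝ) (a b : ℝ) (L : ℝ → Vec n → Vec m → ℝ) (y : ℝ → Vec n) (u : ℝ → Vec m) : ℝ :=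
  deltaIntegral T a b (fun t => L t (y t) (u t))

/-- Admissible pairs of the Lagrange problem. Each boundary condition may be present
(`some` prescribed value) or absent (`none`). -/
structure IsAdmissible (T : Set ℝ) (a b : ℝ) (φ : ℝ → Vec n → Vec m → Vec n)
    (ya yb : Option (Vec n)) (y : ℝ → Vec n) (u : ℝ → Vec m) : Prop where
  state : IsC1rd T b y
  control : RdContinuousOn T T u
  dynamics : ∀ t ∈ kappa T b, HasDeltaDeriv T y (φ t (y t) (u t)) t
  left : ∀ c ∈ ya, y a = c
  right : ∀ c ∈ yb, y b = c

/-- Weak local minimizers of the Lagrange problem: the competitors `(y, u)` are the admissible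
pairs with `‖y - y*‖_{1,∞} + ‖u - u*‖_∞ < δ`. -/
def IsWeakLocalMinimizer (T : Set ℝ) (a b : ℝ) (L : ℝ → Vec n → Vec m → ℝ)
    (φ : ℝ → Vec n → Vec m → Vec n) (ya yb : Option (Vec n))
    (ystar : ℝ → Vec n) (ustar : ℝ → Vec m) : Prop :=
  IsAdmissible T a b φ ya yb ystar ustar ∧
  ∃ δ : ℝ, 0 < δ ∧ ∀ (y : ℝ → Vec n) (u : ℝ → Vec m), IsAdmissible T a b φ ya yb y u →
    supNorm T b (fun t => y t - ystar t) + supNorm T b (deltaDeriv T (fun t => y t - ystar t))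
      + supNorm T b (fun t => u t - ustar t) < ENNReal.ofReal δ →
    cost T a b L ystar ustar ≤ cost T a b L y u

/-- The integrand of the augmented functional,
`L*(t, y, u, p, v) = ψ₀ L(t, y, u) + p · (φ(t, y, u) - v)`,
evaluated in that functional at `p = ψ^σ(t)`, `v = y^Δ(t)`. -/
def augmented (L : ℝ → Vec n → Vec m → ℝ) (φ : ℝ → Vec n → Vec m → Vec n) (ψ₀ : ℝ)
    (t : ℝ) (y : Vec n) (u : Vec m) (p v : Vec n) : ℝ :=
  ψ₀ * L t y u + inner ℝ p (φ t y u - v)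

section Partials

variable (M : ℝ → Vec n → Vec m → Vec n → Vec n → ℝ) (T : Set ℝ)
  (y : ℝ → Vec n) (u : ℝ → Vec m) (ψ : ℝ → Vec n) (t : ℝ)

/-- The partial gradient `M_y` of an integrand `M(t, y, u, p, v)` at
`(t, y(t), u(t), ψ^σ(t), y^Δ(t))`. -/
def partialY : Vec n :=
  gradient (fun x => M t x (u t) (ψ (sigma T t)) (deltaDeriv T y t)) (y t)

/-- `M_u` at the same point. -/
def partialU : Vec m :=
  gradient (fun w => M t (y t) w (ψ (sigma T t)) (deltaDeriv T y t)) (u t)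

/-- `M_{ψ^σ}` at the same point. -/
def partialPsi : Vec n :=
  gradient (fun p => M t (y t) (u t) p (deltaDeriv T y t)) (ψ (sigma T t))

/-- `M_{y^Δ}` at the same point. -/
def partialYDelta : Vec n :=
  gradient (fun v => M t (y t) (u t) (ψ (sigma T t)) v) (deltaDeriv T y t)

end Partials

/-- The Euler-Lagrange equations of
`∫_a^b M(t, y(t), u(t), ψ^σ(t), y^Δ(t)) Δt` with respect to `y`, `u` and `ψ`. The equation for `u`
is given both in its delta differentiated form (with `M_{u^Δ} = 0`) and as the stationarity
condition `M_u = 0` on all of `T^k`. -/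
structure SatisfiesEulerLagrange (M : ℝ → Vec n → Vec m → Vec n → Vec n → ℝ) (T : Set ℝ) (b : ℝ)
    (y : ℝ → Vec n) (u : ℝ → Vec m) (ψ : ℝ → Vec n) : Prop where
  /-- `(M_{y^Δ} - μ M_y)^Δ = M_y` -/
  eq_y : ∀ t ∈ kappa T b, HasDeltaDeriv T
    (fun s => partialYDelta M T y u ψ s - mu T s • partialY M T y u ψ s)
    (partialY M T y u ψ t) t
  /-- `(-μ M_u)^Δ = M_u` -/
  eq_u : ∀ t ∈ kappa T b, HasDeltaDeriv T
    (fun s => -(mu T s • partialU M T y u ψ s)) (partialU M T y u ψ t) t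
  stationary_u : ∀ t ∈ kappa T b, partialU M T y u ψ t = 0
  eq_ψ : ∀ t ∈ kappa T b, partialPsi M T y u ψ t = 0

end TimeScale

end

namespace TimeScale

/-! ### Jump operators -/

section Jump

variable {T : Set ℝ} {a b t s : ℝ}

/-! Adjoin the accumulated cost `c`, with `c^Δ = L(t, y, u)` and `c(a) = 0`, to the state. By
minimality no nearby trajectory of the extended system with the same initial value ends at `(y(b),
c(b) - s)`, `s > 0`, so endpoints of nearby trajectories do not fill a neighborhood of `(y(b),
c(b))`. By `eventually_exists_trajectory`, which rests on the open mapping property of strictly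
differentiable maps with surjective derivative, the linearized system is then not controllable. A
nonzero functional vanishing on its reachable subspace, carried backwards from `b` by the adjoint
equation `p^Δ = -p^σ D_y`, is a costate that annihilates all control variations
(`controllable_or_exists_costate`). Its cost component is constant, because the right-hand side does
not involve `c`, and gives `ψ₀`; its state component gives `ψ`. The competitors keep both endpoints
of `y`, so it does not matter which boundary conditions are imposed.

The analysis takes place in the bounded continuous functions on `ℝ`. Delta integrals are Lebesgue
integrals of `g ∘ proj T`, and dynamic equations become Volterra equations. The forward equation
evaluates the state at `t` and the adjoint one at `σ(t)`; both operators then have iterates of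
factorial decay, and no regressivity is needed. Controls are varied only in a finite-dimensional
family, so the space of controls needs no norm. -/

theorem sigma_of_lt (ht : ∃ s ∈ T, t < s) : sigma T t = sInf (T ∩ Ioi t) := by
  obtain ⟨s, hs, hts⟩ := ht
  exact if_pos ⟨s, hs, hts⟩

theorem bddBelow_inter_Ioi : BddBelow (T ∩ Ioi t) := ⟨t, fun _ h => le_of_lt h.2⟩

theorem bddAbove_inter_Iio : BddAbove (T ∩ Iio t) := ⟨t, fun _ h => le_of_lt h.2⟩

theorem sigma_le (hs : s ∈ T) (hts : t < s) : sigma T t ≤ s := by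
  rw [sigma_of_lt ⟨s, hs, hts⟩]
  exact csInf_le bddBelow_inter_Ioi ⟨hs, hts⟩

theorem le_rho (hs : s ∈ T) (hst : s < t) : s ≤ rho T t := by
  rw [rho, if_pos ⟨s, hs, hst⟩]
  exact le_csSup bddAbove_inter_Iio ⟨hs, hst⟩

theorem mem_kappa_of_lt (ht : t ∈ T) (htb : t < b) : t ∈ kappa T b :=
  ⟨ht, fun h => absurd (le_rho ht htb) (not_le.2 h.1)⟩

namespace IsTimeScaleOn

variable (hT : IsTimeScaleOn T a b)
include hT

theorem subset_Icc : T ⊆ Icc a b := fun _ h => ⟨hT.isLeast.2 h, hT.isGreatest.2 h⟩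

theorem isCompact : IsCompact T := isCompact_Icc.of_isClosed_subset hT.isClosed hT.subset_Icc

theorem left_mem : a ∈ T := hT.isLeast.1

theorem right_mem : b ∈ T := hT.isGreatest.1

theorem sigma_right : sigma T b = b := by
  rw [sigma, if_neg, hT.isGreatest.csSup_eq]
  rintro ⟨s, hs, h⟩
  exact absurd (hT.isGreatest.2 hs) (not_le.2 h)

theorem sigma_eq_sInf (ht : t < b) : sigma T t = sInf (T ∩ Ioi t) :=
  sigma_of_lt ⟨b, hT.right_mem, ht⟩

theorem le_sigma (ht : t ≤ b) : t ≤ sigma T t := by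
  rcases ht.lt_or_eq with h | rfl
  · rw [hT.sigma_eq_sInf h]
    exact le_csInf ⟨b, hT.right_mem, h⟩ fun _ h => le_of_lt h.2
  · exact hT.sigma_right.ge

theorem sigma_mem (ht : t ≤ b) : sigma T t ∈ T := by
  rcases ht.lt_or_eq with h | rfl
  · rw [hT.sigma_eq_sInf h]
    have := csInf_mem_closure (s := T ∩ Ioi t) ⟨b, hT.right_mem, h⟩ bddBelow_inter_Ioi
    exact hT.isClosed.closure_subset_iff.2 inter_subset_left this
  · rw [hT.sigma_right]; exact hT.right_mem

theorem rho_le (ht : a ≤ t) : rho T t ≤ t := by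
  rcases ht.lt_or_eq with h | rfl
  · rw [rho, if_pos ⟨a, hT.left_mem, h⟩]
    exact csSup_le ⟨a, hT.left_mem, h⟩ fun _ h => le_of_lt h.2
  · rw [rho, if_neg, hT.isLeast.csInf_eq]
    rintro ⟨s, hs, h⟩
    exact absurd (hT.isLeast.2 hs) (not_le.2 h)

/-- The gap `(ρ(t), t)` contains no point of `T`, so statements about left limits are vacuous at
left-scattered points. -/
theorem nhdsWithin_Iio_eq_bot (ht : t ∈ T) (h : rho T t ≠ t) : 𝓝[T ∩ Iio t] t = ⊥ := by
  have hlt := lt_of_le_of_ne (hT.rho_le (hT.isLeast.2 ht)) h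
  rw [← empty_mem_iff_bot]
  filter_upwards [self_mem_nhdsWithin, mem_nhdsWithin_of_mem_nhds (Ioi_mem_nhds hlt)] with s hs hs'
  exact absurd (le_rho hs.1 hs.2) (not_le.2 hs')

theorem nhdsWithin_Ici_eq_pure (ht : t ∈ T) (h : sigma T t ≠ t) : 𝓝[T ∩ Ici t] t = pure t := by
  have hlt := lt_of_le_of_ne (hT.le_sigma (hT.isGreatest.2 ht)) h.symm
  refine le_antisymm ?_ (pure_le_nhdsWithin ⟨ht, self_mem_Ici⟩)
  rw [le_pure_iff]
  filter_upwards [self_mem_nhdsWithin, mem_nhdsWithin_of_mem_nhds (Iio_mem_nhds hlt)] with s hs hs'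
  by_contra hne
  exact absurd (sigma_le hs.1 (lt_of_le_of_ne hs.2 (Ne.symm hne))) (not_le.2 hs')

theorem exists_mem_Ioo (htb : t < b) (h : sigma T t = t) {c : ℝ} (hc : t < c) :
    ∃ s ∈ T, s ∈ Ioo t c := by
  have hlt : sInf (T ∩ Ioi t) < c := by rwa [← hT.sigma_eq_sInf htb, h]
  obtain ⟨s, hs, hsc⟩ := exists_lt_of_csInf_lt (s := T ∩ Ioi t) ⟨b, hT.right_mem, htb⟩ hlt
  exact ⟨s, hs.1, hs.2, hsc⟩

theorem rho_right_of_mem_kappa (h : b ∈ kappa T b) : rho T b = b := by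
  refine le_antisymm (hT.rho_le hT.lt.le) ?_
  by_contra hlt
  exact h.2 ⟨not_le.1 hlt, le_rfl⟩

/-- Every point of `T^k` can be approached by points `s` of `T` with `σ(t) ≠ s`. -/
theorem exists_ne_sigma (ht : t ∈ kappa T b) {δ : ℝ} (hδ : 0 < δ) :
    ∃ s ∈ T, |s - t| < δ ∧ sigma T t ≠ s := by
  by_cases h : sigma T t = t
  · rcases (hT.isGreatest.2 ht.1).lt_or_eq with htb | rfl
    · obtain ⟨s, hs, h1, h2⟩ := hT.exists_mem_Ioo htb h (lt_add_of_pos_right t hδ)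
      exact ⟨s, hs, by rw [abs_of_pos (by linarith)]; linarith, by rw [h]; exact h1.ne⟩
    · have hρ := hT.rho_right_of_mem_kappa ht
      have hlt : t - δ < sSup (T ∩ Iio t) := by
        rw [rho, if_pos ⟨a, hT.left_mem, hT.lt⟩] at hρ
        rw [hρ]; linarith
      obtain ⟨s, hs, hs'⟩ := exists_lt_of_lt_csSup (s := T ∩ Iio t) ⟨a, hT.left_mem, hT.lt⟩ hlt
      have : s < t := hs.2
      exact ⟨s, hs.1, by rw [abs_of_neg (by linarith)]; linarith, by rw [h]; exact this.ne'⟩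
  · exact ⟨t, ht.1, by simpa using hδ, h⟩

end IsTimeScaleOn

theorem nhdsWithin_eq_sup (T : Set ℝ) (t : ℝ) : 𝓝[T] t = 𝓝[T ∩ Iio t] t ⊔ 𝓝[T ∩ Ici t] t := by
  rw [← nhdsWithin_union, ← inter_union_distrib_left, Iio_union_Ici, inter_univ]

end Jump

/-! ### Delta derivatives -/

section Deriv

variable {E F : Type*} [NormedAddCommGroup E] [NormedSpace ℝ E] [NormedAddCommGroup F]
  [NormedSpace ℝ F] {T : Set ℝ} {a b t : ℝ}

theorem HasDeltaDeriv.congr {f g : ℝ → E} {f' : E} (h : HasDeltaDeriv T f f' t)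
    (hfg : ∀ s ∈ T, g s = f s) (ht : sigma T t ∈ T) : HasDeltaDeriv T g f' t := by
  intro ε hε
  obtain ⟨δ, hδ, H⟩ := h ε hε
  exact ⟨δ, hδ, fun s hs hst => by rw [hfg s hs, hfg _ ht]; exact H s hs hst⟩

theorem hasDeltaDeriv_const (c : E) : HasDeltaDeriv T (fun _ => c) 0 t := fun ε hε =>
  ⟨1, one_pos, fun s _ _ => by simpa using mul_nonneg hε.le (abs_nonneg _)⟩

theorem HasDeltaDeriv.sub {f g : ℝ → E} {f' g' : E} (hf : HasDeltaDeriv T f f' t)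
    (hg : HasDeltaDeriv T g g' t) : HasDeltaDeriv T (fun s => f s - g s) (f' - g') t := by
  intro ε hε
  obtain ⟨δ₁, h₁, H₁⟩ := hf (ε / 2) (half_pos hε)
  obtain ⟨δ₂, h₂, H₂⟩ := hg (ε / 2) (half_pos hε)
  refine ⟨min δ₁ δ₂, lt_min h₁ h₂, fun s hs hst => ?_⟩
  have e : f (sigma T t) - g (sigma T t) - (f s - g s) - (sigma T t - s) • (f' - g')
      = (f (sigma T t) - f s - (sigma T t - s) • f')
        - (g (sigma T t) - g s - (sigma T t - s) • g') := by
    rw [smul_sub]; abel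
  rw [e]
  refine (norm_sub_le _ _).trans ?_
  have := H₁ s hs (hst.trans_le (min_le_left _ _))
  have := H₂ s hs (hst.trans_le (min_le_right _ _))
  linarith

theorem HasDeltaDeriv.clm_comp {f : ℝ → E} {f' : E} (hf : HasDeltaDeriv T f f' t) (A : E →L[ℝ] F) :
    HasDeltaDeriv T (fun s => A (f s)) (A f') t := by
  intro ε hε
  have hA : 0 < ‖A‖ + 1 := by positivity
  obtain ⟨δ, hδ, H⟩ := hf (ε / (‖A‖ + 1)) (div_pos hε hA)
  refine ⟨δ, hδ, fun s hs hst => ?_⟩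
  rw [← map_smul, ← map_sub, ← map_sub]
  refine (A.le_opNorm _).trans ?_
  calc ‖A‖ * _ ≤ (‖A‖ + 1) * (ε / (‖A‖ + 1) * |sigma T t - s|) := by
        gcongr
        · linarith
        · exact H s hs hst
    _ = ε * |sigma T t - s| := by field_simp

theorem HasDeltaDeriv.neg {f : ℝ → E} {f' : E} (hf : HasDeltaDeriv T f f' t) :
    HasDeltaDeriv T (fun s => -f s) (-f') t := by
  simpa using hf.clm_comp (-ContinuousLinearMap.id ℝ E)

theorem HasDeltaDeriv.prodMk {f : ℝ → E} {g : ℝ → F} {f' : E} {g' : F}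
    (hf : HasDeltaDeriv T f f' t) (hg : HasDeltaDeriv T g g' t) :
    HasDeltaDeriv T (fun s => (f s, g s)) (f', g') t := by
  intro ε hε
  obtain ⟨δ₁, h₁, H₁⟩ := hf ε hε
  obtain ⟨δ₂, h₂, H₂⟩ := hg ε hε
  exact ⟨min δ₁ δ₂, lt_min h₁ h₂, fun s hs hst =>
    max_le (H₁ s hs (hst.trans_le (min_le_left _ _))) (H₂ s hs (hst.trans_le (min_le_right _ _)))⟩

/-- Taking `s = t` in the definition bounds the defect by `ε * |μ(t)|` for every `ε`. -/
theorem HasDeltaDeriv.apply_sigma {f : ℝ → E} {f' : E} (hf : HasDeltaDeriv T f f' t) (ht : t ∈ T) :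
    f (sigma T t) = f t + mu T t • f' := by
  have h0 : ‖f (sigma T t) - f t - mu T t • f'‖ ≤ 0 := by
    refine le_of_forall_pos_le_add fun ε hε => ?_
    have hm : 0 < |mu T t| + 1 := by positivity
    obtain ⟨δ, hδ, H⟩ := hf (ε / (|mu T t| + 1)) (div_pos hε hm)
    have := H t ht (by simpa using hδ)
    rw [zero_add]
    refine this.trans ?_
    change ε / (|mu T t| + 1) * |mu T t| ≤ ε
    rw [div_mul_eq_mul_div, div_le_iff₀ hm]
    nlinarith
  have := norm_le_zero_iff.1 h0
  rw [sub_eq_zero, sub_eq_iff_eq_add'] at this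
  exact this

theorem HasDeltaDeriv.continuousWithinAt {f : ℝ → E} {f' : E} (hf : HasDeltaDeriv T f f' t)
    (ht : t ∈ T) : ContinuousWithinAt f T t := by
  rw [Metric.continuousWithinAt_iff]
  intro ε hε
  have hm : 0 < |mu T t| + 1 := by positivity
  have hp : 0 < ‖f'‖ + 1 := by positivity
  obtain ⟨δ, hδ, H⟩ := hf (ε / (2 * (|mu T t| + 1))) (by positivity)
  refine ⟨min δ (min 1 (ε / (2 * (‖f'‖ + 1)))), by positivity, fun s hs hst => ?_⟩
  rw [Real.dist_eq, lt_min_iff, lt_min_iff] at hst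
  obtain ⟨h1, h2, h3⟩ := hst
  have h := H s hs h1
  rw [hf.apply_sigma ht] at h
  have e : f t + mu T t • f' - f s - (sigma T t - s) • f' = -((f s - f t) - (s - t) • f') := by
    have : sigma T t - s = mu T t - (s - t) := by simp [mu]
    rw [this, sub_smul]; abel
  rw [e, norm_neg] at h
  have h4 : |sigma T t - s| ≤ |mu T t| + 1 := by
    have : sigma T t - s = mu T t - (s - t) := by simp [mu]
    rw [this]
    exact (abs_sub _ _).trans (by linarith)
  have h5 : ‖(f s - f t) - (s - t) • f'‖ ≤ ε / 2 := by
    refine h.trans ((mul_le_mul_of_nonneg_left h4 (by positivity)).trans_eq ?_)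
    field_simp
  have h6 : ‖(s - t) • f'‖ < ε / 2 := by
    rw [norm_smul, Real.norm_eq_abs]
    calc |s - t| * ‖f'‖ ≤ |s - t| * (‖f'‖ + 1) := by gcongr; linarith
      _ < ε / (2 * (‖f'‖ + 1)) * (‖f'‖ + 1) := by gcongr
      _ = ε / 2 := by field_simp
  rw [dist_eq_norm]
  calc ‖f s - f t‖ = ‖((f s - f t) - (s - t) • f') + (s - t) • f'‖ := by rw [sub_add_cancel]
    _ ≤ _ := norm_add_le _ _
    _ < ε := by linarith

/-- The defining inequality can be divided by `|σ(t) - s|` for suitable `s` near `t`. This fails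
only at a left-scattered maximum, which `T^k` omits. -/
theorem HasDeltaDeriv.unique (hT : IsTimeScaleOn T a b) {f : ℝ → E} {f' g' : E}
    (ht : t ∈ kappa T b) (hf : HasDeltaDeriv T f f' t) (hg : HasDeltaDeriv T f g' t) :
    f' = g' := by
  have h := hf.sub hg
  have h0 : ‖f' - g'‖ ≤ 0 := by
    refine le_of_forall_pos_le_add fun ε hε => ?_
    obtain ⟨δ, hδ, H⟩ := h ε hε
    obtain ⟨s, hs, hst, hne⟩ := hT.exists_ne_sigma ht hδ
    have := H s hs hst
    simp only [sub_self, zero_sub, norm_neg, norm_smul, Real.norm_eq_abs] at this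
    rw [mul_comm ε] at this
    rw [zero_add]
    exact le_of_mul_le_mul_left this (abs_pos.2 (sub_ne_zero.2 hne))
  exact sub_eq_zero.1 (norm_le_zero_iff.1 h0)

theorem HasDeltaDeriv.deltaDeriv_eq (hT : IsTimeScaleOn T a b) {f : ℝ → E} {f' : E}
    (ht : t ∈ kappa T b) (hf : HasDeltaDeriv T f f' t) : deltaDeriv T f t = f' := by
  have h : DeltaDifferentiableAt T f t := ⟨f', hf⟩
  rw [deltaDeriv, dif_pos h]
  exact HasDeltaDeriv.unique hT ht h.choose_spec hf

/-- Product rule `(p f)^Δ = p^σ f^Δ + p^Δ f` for the evaluation of operators. -/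
theorem HasDeltaDeriv.clm_apply {p : ℝ → E →L[ℝ] F} {f : ℝ → E} {p' : E →L[ℝ] F} {f' : E}
    (hp : HasDeltaDeriv T p p' t) (hf : HasDeltaDeriv T f f' t) (ht : t ∈ T) :
    HasDeltaDeriv T (fun s => p s (f s)) (p (sigma T t) f' + p' (f t)) t := by
  intro ε hε
  set P := ‖p (sigma T t)‖ + 1
  have hP : 0 < P := by positivity
  have hQ : 0 < ‖p'‖ + 1 := by positivity
  have hR : 0 < ‖f t‖ + 1 := by positivity
  obtain ⟨δ₁, h₁, H₁⟩ := hf (ε / 3 / P) (by positivity)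
  obtain ⟨δ₂, h₂, H₂⟩ := hp (ε / 3 / (‖f t‖ + 1)) (by positivity)
  obtain ⟨δ₃, h₃, H₃⟩ := Metric.continuousWithinAt_iff.1 (hf.continuousWithinAt ht)
    (min 1 (ε / 3 / (‖p'‖ + 1))) (by positivity)
  refine ⟨min δ₁ (min δ₂ δ₃), by positivity, fun s hs hst => ?_⟩
  rw [lt_min_iff, lt_min_iff] at hst
  have k₁ := H₁ s hs hst.1
  have k₂ := H₂ s hs hst.2.1
  have k₃ := H₃ hs (by rw [Real.dist_eq]; exact hst.2.2)
  rw [dist_eq_norm, lt_min_iff] at k₃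
  set d := sigma T t - s
  -- The last term exchanges `f s` for `f t` under `p'`; it is small by continuity of `f` at `t`.
  have e : p (sigma T t) (f (sigma T t)) - p s (f s) - d • (p (sigma T t) f' + p' (f t))
      = p (sigma T t) (f (sigma T t) - f s - d • f') + (p (sigma T t) - p s - d • p') (f s)
        + d • p' (f s - f t) := by
    simp only [map_sub, map_smul, sub_apply, smul_apply,
      smul_add, smul_sub]
    abel
  have hfs : ‖f s‖ ≤ ‖f t‖ + 1 := by
    have := norm_le_norm_add_norm_sub' (f s) (f t)
    linarith [k₃.1]
  rw [e]
  have q₁ : ‖p (sigma T t) (f (sigma T t) - f s - d • f')‖ ≤ ε / 3 * |d| := by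
    calc _ ≤ ‖p (sigma T t)‖ * _ := ContinuousLinearMap.le_opNorm _ _
      _ ≤ P * (ε / 3 / P * |d|) := by gcongr; simp [P]
      _ = ε / 3 * |d| := by field_simp
  have q₂ : ‖(p (sigma T t) - p s - d • p') (f s)‖ ≤ ε / 3 * |d| := by
    calc _ ≤ ‖p (sigma T t) - p s - d • p'‖ * ‖f s‖ := ContinuousLinearMap.le_opNorm _ _
      _ ≤ ε / 3 / (‖f t‖ + 1) * |d| * (‖f t‖ + 1) := by gcongr
      _ = ε / 3 * |d| := by field_simp
  have q₃ : ‖d • p' (f s - f t)‖ ≤ ε / 3 * |d| := by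
    rw [norm_smul, Real.norm_eq_abs]
    calc |d| * ‖p' (f s - f t)‖ ≤ |d| * (‖p'‖ * ‖f s - f t‖) := by
          gcongr; exact ContinuousLinearMap.le_opNorm _ _
      _ ≤ |d| * ((‖p'‖ + 1) * (ε / 3 / (‖p'‖ + 1))) := by
          gcongr
          · linarith
          · exact k₃.2.le
      _ = ε / 3 * |d| := by field_simp
  calc _ ≤ _ := norm_add₃_le
    _ ≤ ε * |d| := by linarith

/-- A function that is delta differentiable on `T^k` is continuous on `T`. -/
theorem IsTimeScaleOn.continuousOn_of_hasDeltaDeriv (hT : IsTimeScaleOn T a b) {f g : ℝ → E}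
    (hf : ∀ t ∈ kappa T b, HasDeltaDeriv T f (g t) t) : ContinuousOn f T := by
  intro t ht
  by_cases hk : t ∈ kappa T b
  · exact (hf t hk).continuousWithinAt ht
  · obtain rfl : t = b := by
      by_contra hne
      exact hk (mem_kappa_of_lt ht (lt_of_le_of_ne (hT.isGreatest.2 ht) hne))
    -- A maximum outside `T^k` is left-scattered, hence isolated in `T`.
    have hρ : rho T t ≠ t := fun h => hk ⟨ht, fun h' => absurd h'.1 (by rw [h]; exact lt_irrefl _)⟩
    rw [ContinuousWithinAt, nhdsWithin_eq_sup, hT.nhdsWithin_Iio_eq_bot ht hρ, bot_sup_eq]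
    have : T ∩ Ici t = {t} := Subset.antisymm
      (fun s hs => le_antisymm (hT.isGreatest.2 hs.1) hs.2)
      (by rintro _ rfl; exact ⟨ht, self_mem_Ici⟩)
    rw [this, nhdsWithin_singleton]
    exact tendsto_pure_nhds _ _

/-- A function with vanishing delta derivative is constant. -/
theorem IsTimeScaleOn.eq_left_of_hasDeltaDeriv_zero (hT : IsTimeScaleOn T a b) {f : ℝ → E}
    (hf : ∀ t ∈ kappa T b, HasDeltaDeriv T f 0 t) (t : ℝ) (ht : t ∈ T) : f t = f a := by
  have hcont := hT.continuousOn_of_hasDeltaDeriv (g := fun _ => 0) hf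
  suffices H : ∀ ε > 0, ∀ s ∈ T, ‖f s - f a‖ ≤ ε * (s - a) by
    have h0 : ‖f t - f a‖ ≤ 0 := by
      refine le_of_forall_pos_le_add fun ε hε => ?_
      have hb : 0 < b - a + 1 := by linarith [hT.lt]
      have := H (ε / (b - a + 1)) (by positivity) t ht
      rw [zero_add]
      refine this.trans ?_
      rw [div_mul_eq_mul_div, div_le_iff₀ hb]
      have := hT.isGreatest.2 ht
      gcongr
      linarith
    exact sub_eq_zero.1 (norm_le_zero_iff.1 h0)
  intro ε hε
  -- Induction along `T`: the supremum `c` of `S` lies in `S` by continuity. If `c < b`, then `S`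
  -- extends beyond `c`, by the derivative estimate when `c` is right-dense and by `f(σ(c)) = f(c)`
  -- when it is right-scattered.
  set S : Set ℝ := {t ∈ T | ∀ s ∈ T, s ≤ t → ‖f s - f a‖ ≤ ε * (s - a)} with hS
  have haS : a ∈ S := ⟨hT.left_mem, fun s hs hsa => by
    rw [le_antisymm hsa (hT.isLeast.2 hs)]; simp⟩
  have hbdd : BddAbove S := ⟨b, fun s hs => hT.isGreatest.2 hs.1⟩
  set c := sSup S
  have hcl : c ∈ closure S := csSup_mem_closure ⟨a, haS⟩ hbdd
  have hcT : c ∈ T := hT.isClosed.closure_subset_iff.2 (fun s hs => hs.1) hcl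
  have hcS : c ∈ S := by
    refine ⟨hcT, fun s hs hsc => ?_⟩
    rcases hsc.lt_or_eq with h | rfl
    · obtain ⟨r, hr, hsr⟩ := exists_lt_of_lt_csSup ⟨a, haS⟩ h
      exact hr.2 s hs hsr.le
    · have hc : ContinuousWithinAt (fun s => ‖f s - f a‖) S c :=
        (((hcont c hcT).mono fun s hs => hs.1).sub continuousWithinAt_const).norm
      exact ContinuousWithinAt.closure_le hcl hc
        (by fun_prop) fun s hs => hs.2 s hs.1 le_rfl
  suffices hcb : c = b from fun s hs => hcS.2 s hs (hcb ▸ hT.isGreatest.2 hs)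
  by_contra hne
  have hcb : c < b := lt_of_le_of_ne (hT.isGreatest.2 hcT) hne
  have hd := hf c (mem_kappa_of_lt hcT hcb)
  have hfc := hcS.2 c hcT le_rfl
  by_cases hσ : sigma T c = c
  · obtain ⟨δ, hδ, H⟩ := hd ε hε
    obtain ⟨r, hr, hcr, hrδ⟩ := hT.exists_mem_Ioo hcb hσ (lt_add_of_pos_right c hδ)
    refine absurd (le_csSup hbdd (⟨hr, fun s hs hsr => ?_⟩ : r ∈ S)) (not_le.2 hcr)
    rcases le_or_gt s c with h | h
    · exact hcS.2 s hs h
    · have := H s hs (by rw [abs_of_pos (by linarith)]; linarith)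
      rw [hσ, smul_zero, sub_zero, norm_sub_rev, abs_sub_comm, abs_of_pos (sub_pos.2 h)] at this
      calc ‖f s - f a‖ ≤ ‖f s - f c‖ + ‖f c - f a‖ := norm_sub_le_norm_sub_add_norm_sub _ _ _
        _ ≤ ε * (s - a) := by linarith
  · have hlt := lt_of_le_of_ne (hT.le_sigma hcb.le) (Ne.symm hσ)
    refine absurd (le_csSup hbdd (⟨hT.sigma_mem hcb.le, fun s hs hsr => ?_⟩ : sigma T c ∈ S))
      (not_le.2 hlt)
    rcases le_or_gt s c with h | h
    · exact hcS.2 s hs h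
    · obtain rfl := le_antisymm hsr (sigma_le hs h)
      rw [hd.apply_sigma hcT, smul_zero, add_zero]
      exact hfc.trans (by gcongr)

/-- Functions with the same delta derivative and the same initial value agree. -/
theorem IsTimeScaleOn.eq_of_hasDeltaDeriv (hT : IsTimeScaleOn T a b) {f g h : ℝ → E}
    (hf : ∀ t ∈ kappa T b, HasDeltaDeriv T f (h t) t)
    (hg : ∀ t ∈ kappa T b, HasDeltaDeriv T g (h t) t) (ha : f a = g a) (t : ℝ) (ht : t ∈ T) :
    f t = g t := by
  have := hT.eq_left_of_hasDeltaDeriv_zero (f := fun s => f s - g s)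
    (fun s hs => by simpa using (hf s hs).sub (hg s hs)) t ht
  rwa [ha, sub_self, sub_eq_zero] at this

theorem deltaIntegral_eq (hT : IsTimeScaleOn T a b) {f F : ℝ → E} (hF : IsAntiderivative T b F f) :
    deltaIntegral T a b f = F b - F a := by
  have h : ∃ F : ℝ → E, IsAntiderivative T b F f := ⟨F, hF⟩
  rw [deltaIntegral, dif_pos h]
  have := hT.eq_left_of_hasDeltaDeriv_zero (f := fun s => h.choose s - F s)
    (fun s hs => by simpa using (h.choose_spec s hs).sub (hF s hs)) b hT.right_mem
  rw [sub_eq_iff_eq_add] at this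
  rw [this]; abel

end Deriv

end TimeScale

/-- A right-continuous function on the line is measurable. -/
theorem stronglyMeasurable_of_continuousWithinAt_Ici {E : Type*} [TopologicalSpace E]
    [TopologicalSpace.PseudoMetrizableSpace E] {g : ℝ → E}
    (hg : ∀ x, ContinuousWithinAt g (Ici x) x) : MeasureTheory.StronglyMeasurable g := by
  -- The sample points lie to the right of `x` and within `1 / (k + 1)` of it; each approximant
  -- factors through the countable space `ℤ`.
  refine stronglyMeasurable_of_tendsto atTop
    (f := fun (k : ℕ) (x : ℝ) => g ((⌊((k : ℝ) + 1) * x⌋ + 1) / ((k : ℝ) + 1))) (fun k => ?_) ?_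
  · have h : MeasureTheory.StronglyMeasurable
        (fun i : ℤ => g (((i : ℝ) + 1) / ((k : ℝ) + 1))) := .of_discrete
    exact h.comp_measurable (Int.measurable_floor.comp (measurable_const.mul measurable_id))
  · rw [tendsto_pi_nhds]
    intro x
    have hle : ∀ k : ℕ, x ≤ (⌊((k : ℝ) + 1) * x⌋ + 1) / ((k : ℝ) + 1) := fun k => by
      rw [le_div_iff₀ (by positivity), mul_comm]
      exact (Int.lt_floor_add_one _).le
    refine (hg x).tendsto.comp (tendsto_nhdsWithin_iff.2 ⟨?_, Eventually.of_forall hle⟩)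
    refine tendsto_of_tendsto_of_tendsto_of_le_of_le tendsto_const_nhds
      (h := fun k : ℕ => x + 1 / ((k : ℝ) + 1)) ?_ hle fun k => ?_
    · simpa using tendsto_const_nhds.add (tendsto_one_div_add_atTop_nhds_zero_nat (𝕜 := ℝ))
    · have : (0 : ℝ) < (k : ℝ) + 1 := by positivity
      change _ / _ ≤ _
      rw [div_le_iff₀ this]
      have := Int.floor_le (((k : ℝ) + 1) * x)
      field_simp
      linarith

namespace TimeScale

/-! ### The last point of the time scale before a given time -/

/-- The last point of `T` that is at most `x`. -/
noncomputable def proj (T : Set ℝ) (x : ℝ) : ℝ := sSup (T ∩ Iic x)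

section Proj

variable {T : Set ℝ} {a b t s x : ℝ}

theorem le_proj (hs : s ∈ T) (hsx : s ≤ x) : s ≤ proj T x :=
  le_csSup ⟨x, fun _ h => h.2⟩ ⟨hs, hsx⟩

theorem proj_eq (hx : x ∈ T) : proj T x = x :=
  IsGreatest.csSup_eq ⟨⟨hx, self_mem_Iic⟩, fun _ h => h.2⟩

namespace IsTimeScaleOn

variable (hT : IsTimeScaleOn T a b)
include hT

theorem proj_isGreatest (hx : a ≤ x) : IsGreatest (T ∩ Iic x) (proj T x) :=
  ⟨(hT.isClosed.inter isClosed_Iic).csSup_mem ⟨a, hT.left_mem, hx⟩ ⟨x, fun _ h => h.2⟩,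
    fun _ h => le_proj h.1 h.2⟩

theorem proj_mem (hx : a ≤ x) : proj T x ∈ T := (hT.proj_isGreatest hx).1.1

theorem proj_le (hx : a ≤ x) : proj T x ≤ x := (hT.proj_isGreatest hx).1.2

/-- This is the default value of `sSup ∅`. It makes `g ∘ proj T` constant below `a`, which is enough
for measurability on the whole line. -/
theorem proj_of_lt (hx : x < a) : proj T x = 0 := by
  have : T ∩ Iic x = ∅ := by
    ext s
    simp only [mem_inter_iff, mem_Iic, mem_empty_iff_false, iff_false, not_and, not_le]
    exact fun hs => hx.trans_le (hT.isLeast.2 hs)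
  rw [proj, this, Real.sSup_empty]

theorem proj_eq_of_mem_Ico (ht : t ∈ T) (hx : x ∈ Ico t (sigma T t)) : proj T x = t := by
  have hax := (hT.isLeast.2 ht).trans hx.1
  refine le_antisymm ?_ (le_proj ht hx.1)
  by_contra h
  exact absurd ((sigma_le (hT.proj_mem hax) (not_le.1 h)).trans (hT.proj_le hax)) (not_le.2 hx.2)

/-- No point of `T` lies in `(proj T x, x]`, so the next point after `proj T x` cannot come before
`x`. This provides the Volterra bound for the backward equation. -/
theorem le_sigma_proj (hx : a ≤ x) (hxb : x ≤ b) : x ≤ sigma T (proj T x) := by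
  by_contra! h
  have hb := hT.isGreatest.2 (hT.proj_mem hx)
  have heq := le_antisymm (le_proj (hT.sigma_mem hb) h.le) (hT.le_sigma hb)
  have hlt : proj T x < x := heq ▸ h
  obtain ⟨s, hs, h1, h2⟩ := hT.exists_mem_Ioo (hlt.trans_le hxb) heq hlt
  exact absurd (le_proj hs h2.le) (not_le.2 h1)

/-- Outside `T` the projection is constant just to the right of `x`, as `T` is closed; at `x ∈ T` it
is squeezed by `x ≤ proj T y ≤ y`. -/
theorem tendsto_proj (hx : a ≤ x) :
    Tendsto (proj T) (𝓝[≥] x) (𝓝[T ∩ Ici (proj T x)] (proj T x)) := by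
  have hmem : ∀ᶠ y in 𝓝[≥] x, proj T y ∈ T ∩ Ici (proj T x) := by
    filter_upwards [self_mem_nhdsWithin] with y hy
    exact ⟨hT.proj_mem (hx.trans hy), le_proj (hT.proj_mem hx) ((hT.proj_le hx).trans hy)⟩
  refine tendsto_nhdsWithin_iff.2 ⟨?_, hmem⟩
  rcases (hT.proj_le hx).lt_or_eq with h | h
  · have hxT : x ∉ T := fun h' => h.ne (proj_eq h')
    obtain ⟨ε, hε, hball⟩ := Metric.isOpen_iff.1 hT.isClosed.isOpen_compl x hxT
    refine tendsto_const_nhds.congr' ?_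
    filter_upwards [self_mem_nhdsWithin, mem_nhdsWithin_of_mem_nhds (Metric.ball_mem_nhds x hε)]
      with y hy hy'
    have hxy : x ≤ y := hy
    have hay := hx.trans hxy
    refine le_antisymm (le_proj (hT.proj_mem hx) ((hT.proj_le hx).trans hxy))
      (le_proj (hT.proj_mem hay) ?_)
    by_contra! hlt
    refine hball (a := proj T y) ?_ (hT.proj_mem hay)
    rw [Metric.mem_ball, Real.dist_eq, abs_of_nonneg (by linarith)] at hy' ⊢
    linarith [hT.proj_le hay]
  · rw [h]
    refine tendsto_of_tendsto_of_tendsto_of_le_of_le' tendsto_const_nhds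
      (tendsto_id.mono_left nhdsWithin_le_nhds) ?_ ?_
    · filter_upwards [hmem] with y hy
      exact h ▸ hy.2
    · filter_upwards [self_mem_nhdsWithin] with y hy
      exact hT.proj_le (hx.trans hy)

end IsTimeScaleOn

end Proj

/-! ### Rd-continuity -/

section Rd

variable {E F G : Type*} [NormedAddCommGroup E] [NormedAddCommGroup F] [NormedAddCommGroup G] {T : Set ℝ} {a b t : ℝ}
  {Z : Type*} [TopologicalSpace Z]

theorem RdContinuousOn.tendsto_left (hT : IsTimeScaleOn T a b) {f : ℝ → E}
    (hf : RdContinuousOn T T f) (ht : t ∈ T) : ∃ l : E, Tendsto f (𝓝[T ∩ Iio t] t) (𝓝 l) := by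
  by_cases h : rho T t = t
  · exact (hf t ht).2 h
  · exact ⟨0, by rw [hT.nhdsWithin_Iio_eq_bot ht h]; exact tendsto_bot⟩

/-- A right-scattered point is isolated from the right, so right continuity holds at every point of
`T`. -/
theorem RdContinuousOn.continuousWithinAt_Ici (hT : IsTimeScaleOn T a b) {f : ℝ → E}
    (hf : RdContinuousOn T T f) (ht : t ∈ T) : ContinuousWithinAt f (T ∩ Ici t) t := by
  by_cases h : sigma T t = t
  · exact ((hf t ht).1 h).mono inter_subset_left
  · rw [ContinuousWithinAt, hT.nhdsWithin_Ici_eq_pure ht h]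
    exact tendsto_pure_nhds _ _

theorem RdContinuousFamily.tendsto_left (hT : IsTimeScaleOn T a b) {f : ℝ → Z → E}
    (hf : RdContinuousFamily T f) (ht : t ∈ T) (z : Z) :
    ∃ l : E, Tendsto (fun p : ℝ × Z => f p.1 p.2) (𝓝[T ∩ Iio t] t ×ˢ 𝓝 z) (𝓝 l) := by
  by_cases h : rho T t = t
  · exact (hf t ht z).2 h
  · exact ⟨0, by rw [hT.nhdsWithin_Iio_eq_bot ht h, bot_prod]; exact tendsto_bot⟩

/-- At a right-scattered `t` time is frozen, and only continuity in the parameter remains; this is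
the role of `hc`. -/
theorem RdContinuousFamily.tendsto_right (hT : IsTimeScaleOn T a b) {f : ℝ → Z → E}
    (hf : RdContinuousFamily T f) (ht : t ∈ T) (hc : Continuous (f t)) (z : Z) :
    Tendsto (fun p : ℝ × Z => f p.1 p.2) (𝓝[T ∩ Ici t] t ×ˢ 𝓝 z) (𝓝 (f t z)) := by
  by_cases h : sigma T t = t
  · exact ((hf t ht z).1 h).mono_left (prod_mono_left _ (nhdsWithin_mono _ inter_subset_left))
  · rw [hT.nhdsWithin_Ici_eq_pure ht h, pure_prod]
    exact tendsto_map'_iff.2 (hc.tendsto z)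

theorem RdContinuousFamily.comp {W : Type*} [NormedAddCommGroup W] {f : ℝ → W → E}
    (hf : RdContinuousFamily T f) {ζ : ℝ → W} (hζ : RdContinuousOn T T ζ) :
    RdContinuousOn T T (fun t => f t (ζ t)) := by
  intro t ht
  refine ⟨fun h => ?_, fun h => ?_⟩
  · exact ((hf t ht (ζ t)).1 h).comp (tendsto_id.prodMk ((hζ t ht).1 h))
  · obtain ⟨l, hl⟩ := (hζ t ht).2 h
    obtain ⟨k, hk⟩ := (hf t ht l).2 h
    exact ⟨k, hk.comp (tendsto_id.prodMk hl)⟩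

theorem RdContinuousOn.comp_continuous {f : ℝ → E} (hf : RdContinuousOn T T f) {g : E → F}
    (hg : Continuous g) : RdContinuousOn T T (fun t => g (f t)) := by
  refine fun t ht => ⟨fun h => hg.continuousAt.comp_continuousWithinAt ((hf t ht).1 h), fun h => ?_⟩
  obtain ⟨l, hl⟩ := (hf t ht).2 h
  exact ⟨g l, (hg.tendsto l).comp hl⟩

theorem RdContinuousOn.prodMk {f : ℝ → E} {g : ℝ → F} (hf : RdContinuousOn T T f)
    (hg : RdContinuousOn T T g) : RdContinuousOn T T (fun t => (f t, g t)) := by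
  refine fun t ht => ⟨fun h => ((hf t ht).1 h).prodMk ((hg t ht).1 h), fun h => ?_⟩
  obtain ⟨l, hl⟩ := (hf t ht).2 h
  obtain ⟨k, hk⟩ := (hg t ht).2 h
  exact ⟨(l, k), hl.prodMk_nhds hk⟩

theorem RdContinuousOn.add {f g : ℝ → E} (hf : RdContinuousOn T T f)
    (hg : RdContinuousOn T T g) : RdContinuousOn T T (fun t => f t + g t) :=
  (hf.prodMk hg).comp_continuous continuous_add

theorem RdContinuousOn.clm_apply [NormedSpace ℝ E] [NormedSpace ℝ F] {A : ℝ → E →L[ℝ] F} {f : ℝ → E} (hA : RdContinuousOn T T A)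
    (hf : RdContinuousOn T T f) : RdContinuousOn T T (fun t => A t (f t)) :=
  (hA.prodMk hf).comp_continuous (g := fun q : (E →L[ℝ] F) × E => q.1 q.2) (by fun_prop)

theorem RdContinuousOn.clm_comp [NormedSpace ℝ E] [NormedSpace ℝ F] [NormedSpace ℝ G]
    {A : ℝ → F →L[ℝ] G} {B : ℝ → E →L[ℝ] F}
    (hA : RdContinuousOn T T A) (hB : RdContinuousOn T T B) :
    RdContinuousOn T T (fun t => (A t).comp (B t)) :=
  (hA.prodMk hB).comp_continuous (g := fun q : (F →L[ℝ] G) × (E →L[ℝ] F) => q.1.comp q.2)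
    (by fun_prop)

theorem rdContinuousOn_of_continuousOn {f : ℝ → E} (hf : ContinuousOn f T) :
    RdContinuousOn T T f := fun t ht =>
  ⟨fun _ => hf t ht, fun _ => ⟨f t, (hf t ht).mono inter_subset_left⟩⟩

theorem RdContinuousOn.mono {S : Set ℝ} {f : ℝ → E} (hf : RdContinuousOn T T f) (hS : S ⊆ T) :
    RdContinuousOn T S f := fun t ht =>
  ⟨fun h => ((hf t (hS ht)).1 h).mono hS, fun h => ((hf t (hS ht)).2 h).imp fun _ hl =>
    hl.mono_left (nhdsWithin_mono _ (inter_subset_inter_left _ hS))⟩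

theorem RdContinuousOn.congr {S : Set ℝ} {f g : ℝ → E} (hf : RdContinuousOn T S f)
    (h : ∀ t ∈ S, g t = f t) : RdContinuousOn T S g := fun t ht =>
  ⟨fun hσ => ((hf t ht).1 hσ).congr h (h t ht), fun hρ => ((hf t ht).2 hρ).imp fun _ hl =>
    hl.congr' (by filter_upwards [self_mem_nhdsWithin] with s hs using (h s hs.1).symm)⟩

/-- The composition of a continuous function with the forward jump is rd-continuous. -/
theorem IsTimeScaleOn.rdContinuousOn_comp_sigma (hT : IsTimeScaleOn T a b) {f : ℝ → E}
    (hf : ContinuousOn f T) : RdContinuousOn T T (fun t => f (sigma T t)) := by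
  have hmem : ∀ t (S : Set ℝ), ∀ᶠ s in 𝓝[T ∩ S] t, sigma T s ∈ T := fun t S => by
    filter_upwards [self_mem_nhdsWithin] with s hs
    exact hT.sigma_mem (hT.isGreatest.2 hs.1)
  -- For `s < t` in `T` one has `s ≤ σ(s) ≤ t`.
  have hleft : ∀ t ∈ T, Tendsto (sigma T) (𝓝[T ∩ Iio t] t) (𝓝[T] t) := by
    intro t ht
    refine tendsto_nhdsWithin_iff.2 ⟨?_, hmem t _⟩
    refine tendsto_of_tendsto_of_tendsto_of_le_of_le' (tendsto_id.mono_left nhdsWithin_le_nhds)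
      tendsto_const_nhds ?_ ?_
    · filter_upwards [self_mem_nhdsWithin] with s hs
      exact hT.le_sigma (hT.isGreatest.2 hs.1)
    · filter_upwards [self_mem_nhdsWithin] with s hs
      exact sigma_le ht hs.2
  intro t ht
  refine ⟨fun h => ?_, fun h => ⟨f t, (hf t ht).tendsto.comp (hleft t ht)⟩⟩
  have hright : Tendsto (sigma T) (𝓝[T ∩ Ici t] t) (𝓝[T] t) := by
    refine tendsto_nhdsWithin_iff.2 ⟨?_, hmem t _⟩
    rcases (hT.isGreatest.2 ht).lt_or_eq with htb | rfl
    · refine tendsto_order.2 ⟨fun c hc => ?_, fun c hc => ?_⟩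
      · filter_upwards [self_mem_nhdsWithin] with s hs
        exact hc.trans_le (hs.2.trans (hT.le_sigma (hT.isGreatest.2 hs.1)))
      · obtain ⟨r, hr, h1, h2⟩ := hT.exists_mem_Ioo htb h hc
        filter_upwards [mem_nhdsWithin_of_mem_nhds (Iio_mem_nhds h1)] with s hs
        exact (sigma_le hr hs).trans_lt h2
    · have : T ∩ Ici t ⊆ {t} := fun s hs => le_antisymm (hT.isGreatest.2 hs.1) hs.2
      refine Tendsto.mono_left ?_ (nhdsWithin_mono t this)
      rw [nhdsWithin_singleton]
      exact (tendsto_pure_nhds _ _).trans_eq (by rw [h])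
  have := (hleft t ht).sup hright
  rw [← nhdsWithin_eq_sup] at this
  change Tendsto _ _ (𝓝 (f (sigma T t)))
  rw [h]
  exact (hf t ht).tendsto.comp this

/-- The left limit and right continuity give a bound near each point; compactness of `T` makes it
global. -/
theorem RdContinuousOn.exists_bound (hT : IsTimeScaleOn T a b) {f : ℝ → E}
    (hf : RdContinuousOn T T f) : ∃ C, ∀ t ∈ T, ‖f t‖ ≤ C := by
  refine hT.isCompact.induction_on (p := fun S => ∃ C, ∀ t ∈ S, ‖f t‖ ≤ C) ⟨0, by simp⟩
    (fun S S' h ⟨C, hC⟩ => ⟨C, fun t ht => hC t (h ht)⟩)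
    (fun S S' ⟨C, hC⟩ ⟨C', hC'⟩ => ⟨max C C', fun t ht => ht.elim
      (fun h => (hC t h).trans (le_max_left _ _)) fun h => (hC' t h).trans (le_max_right _ _)⟩)
    fun t ht => ?_
  obtain ⟨l, hl⟩ := hf.tendsto_left hT ht
  have hr := hf.continuousWithinAt_Ici hT ht
  refine ⟨{s | ‖f s‖ ≤ max (‖l‖ + 1) (‖f t‖ + 1)}, ?_, _, fun s hs => hs⟩
  rw [nhdsWithin_eq_sup]
  refine mem_sup.2 ⟨?_, ?_⟩
  · filter_upwards [hl.norm.eventually (eventually_le_nhds (lt_add_one ‖l‖))] with s hs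
    exact hs.trans (le_max_left _ _)
  · filter_upwards [hr.norm.tendsto.eventually (eventually_le_nhds (lt_add_one ‖f t‖))] with s hs
    exact hs.trans (le_max_right _ _)

/-- An rd-continuous family is equicontinuous along rd-continuous functions. -/
theorem RdContinuousFamily.exists_delta (hT : IsTimeScaleOn T a b) {W : Type*}
    [NormedAddCommGroup W] {f : ℝ → W → E} (hf : RdContinuousFamily T f)
    (hc : ∀ t ∈ T, Continuous (f t)) {ζ : ℝ → W} (hζ : RdContinuousOn T T ζ)
    {ε : ℝ} (hε : 0 < ε) :
    ∃ δ > 0, ∀ t ∈ T, ∀ w, ‖w - ζ t‖ < δ → ‖f t w - f t (ζ t)‖ ≤ ε := by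
  -- Used once from the left, where `k` is the left limit of `ζ`, and once from the right, where `k
  -- = ζ t`.
  have key : ∀ (t : ℝ) (𝓕 : Filter ℝ) (k : W) (l : E), Tendsto ζ 𝓕 (𝓝 k) →
      Tendsto (fun p : ℝ × W => f p.1 p.2) (𝓕 ×ˢ 𝓝 k) (𝓝 l) →
      ∃ δ > 0, ∀ᶠ s in 𝓕, ∀ w, ‖w - ζ s‖ < δ → ‖f s w - f s (ζ s)‖ ≤ ε := by
    intro t 𝓕 k l h1 h2
    have h3 := h2.eventually (Metric.ball_mem_nhds l (half_pos hε))
    obtain ⟨pa, hpa, pb, hpb, H⟩ := eventually_prod_iff.1 h3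
    obtain ⟨r, hr, hball⟩ := Metric.eventually_nhds_iff.1 hpb
    refine ⟨r / 2, half_pos hr, ?_⟩
    filter_upwards [hpa, h1.eventually (Metric.ball_mem_nhds k (half_pos hr))] with s hs hs' w hw
    have hs'' : dist (ζ s) k < r / 2 := hs'
    have e1 : dist (f s (ζ s)) l < ε / 2 := H hs (hball (by linarith))
    have e2 : dist (f s w) l < ε / 2 := by
      refine H hs (hball ?_)
      rw [← dist_eq_norm] at hw
      linarith [dist_triangle w (ζ s) k]
    rw [← dist_eq_norm]
    linarith [dist_triangle_right (f s w) (f s (ζ s)) l]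
  refine hT.isCompact.induction_on
    (p := fun S => ∃ δ > 0, ∀ t ∈ S, ∀ w, ‖w - ζ t‖ < δ → ‖f t w - f t (ζ t)‖ ≤ ε)
    ⟨1, one_pos, by simp⟩ (fun S S' h ⟨δ, hδ, H⟩ => ⟨δ, hδ, fun t ht => H t (h ht)⟩)
    (fun S S' ⟨δ, hδ, H⟩ ⟨δ', hδ', H'⟩ => ⟨min δ δ', lt_min hδ hδ', fun t ht w hw => ht.elim
      (fun h => H t h w (hw.trans_le (min_le_left _ _)))
      fun h => H' t h w (hw.trans_le (min_le_right _ _))⟩)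
    fun t ht => ?_
  obtain ⟨k, hk⟩ := hζ.tendsto_left hT ht
  obtain ⟨l, hl⟩ := hf.tendsto_left hT ht k
  obtain ⟨δ, hδ, H⟩ := key t _ k l hk hl
  obtain ⟨δ', hδ', H'⟩ := key t _ _ _ (hζ.continuousWithinAt_Ici hT ht)
    (hf.tendsto_right hT ht (hc t ht) (ζ t))
  refine ⟨_, ?_, min δ δ', lt_min hδ hδ', fun s hs => hs⟩
  rw [nhdsWithin_eq_sup]
  refine mem_sup.2 ⟨?_, ?_⟩
  · filter_upwards [H] with s hs w hw
    exact hs w (hw.trans_le (min_le_left _ _))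
  · filter_upwards [H'] with s hs w hw
    exact hs w (hw.trans_le (min_le_right _ _))

/-- The space of rd-continuous functions. -/
def rdSubmodule (T : Set ℝ) (E : Type*) [NormedAddCommGroup E] [NormedSpace ℝ E] :
    Submodule ℝ (ℝ → E) where
  carrier := {f | RdContinuousOn T T f}
  add_mem' hf hg := hf.add hg
  zero_mem' := rdContinuousOn_of_continuousOn continuousOn_const
  smul_mem' c _ hf := RdContinuousOn.comp_continuous hf (continuous_const_smul c)

end Rd

section Trajectories

open BoundedContinuousFunction

/-! ### Delta integration of rd-continuous functions -/

section Integral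

variable {E : Type*} [NormedAddCommGroup E] [NormedSpace ℝ E] {T : Set ℝ} {a b t x : ℝ}

omit [NormedSpace ℝ E] in
theorem RdContinuousOn.stronglyMeasurable_comp_proj (hT : IsTimeScaleOn T a b) {g : ℝ → E}
    (hg : RdContinuousOn T T g) : MeasureTheory.StronglyMeasurable (fun x => g (proj T x)) := by
  refine stronglyMeasurable_of_continuousWithinAt_Ici fun x => ?_
  rcases lt_or_ge x a with h | h
  · refine ContinuousAt.continuousWithinAt ?_
    refine (continuousAt_const (y := g 0)).congr ?_
    filter_upwards [Iio_mem_nhds h] with y hy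
    rw [hT.proj_of_lt hy]
  · exact (hg.continuousWithinAt_Ici hT (hT.proj_mem h)).tendsto.comp (hT.tendsto_proj h)

omit [NormedSpace ℝ E] in
theorem RdContinuousOn.intervalIntegrable (hT : IsTimeScaleOn T a b) {g : ℝ → E}
    (hg : RdContinuousOn T T g) (x y : ℝ) :
    IntervalIntegrable (fun s => g (proj T s)) MeasureTheory.volume x y := by
  obtain ⟨C, hC⟩ := hg.exists_bound hT
  rw [intervalIntegrable_iff]
  refine MeasureTheory.IntegrableOn.of_bound measure_Ioc_lt_top
    (hg.stronglyMeasurable_comp_proj hT).aestronglyMeasurable (max C ‖g 0‖)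
    (Eventually.of_forall fun s => ?_)
  rcases lt_or_ge s a with h | h
  · rw [hT.proj_of_lt h]; exact le_max_right _ _
  · exact (hC _ (hT.proj_mem h)).trans (le_max_left _ _)

/-- The retraction of the line onto `[a, b]`. -/
def clamp (a b x : ℝ) : ℝ := max a (min b x)

theorem continuous_clamp : Continuous (clamp a b) := by unfold clamp; fun_prop

theorem le_clamp : a ≤ clamp a b x := le_max_left _ _

theorem clamp_le (hab : a ≤ b) : clamp a b x ≤ b := max_le hab (min_le_left _ _)

theorem clamp_of_mem (hx : x ∈ Icc a b) : clamp a b x = x := by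
  rw [clamp, min_eq_right hx.2, max_eq_right hx.1]

theorem IsTimeScaleOn.clamp_eq (hT : IsTimeScaleOn T a b) (ht : t ∈ T) : clamp a b t = t :=
  clamp_of_mem (hT.subset_Icc ht)

theorem IsTimeScaleOn.norm_integral_le (hT : IsTimeScaleOn T a b) {g : ℝ → E} {C x y : ℝ}
    (hx : a ≤ x) (hy : a ≤ y) (hC : ∀ t ∈ T, ‖g t‖ ≤ C) :
    ‖∫ s in x..y, g (proj T s)‖ ≤ C * |y - x| :=
  intervalIntegral.norm_integral_le_of_norm_le_const fun _ hs =>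
    hC _ (hT.proj_mem ((le_min hx hy).trans hs.1.le))

/-- The delta integrals `∫_a^x g(t) Δt`, as a function of the upper limit. -/
noncomputable def primitive (hT : IsTimeScaleOn T a b) (E : Type*) [NormedAddCommGroup E]
    [NormedSpace ℝ E] : rdSubmodule T E →ₗ[ℝ] (ℝ →ᵇ E) where
  toFun g := BoundedContinuousFunction.ofNormedAddCommGroup
    (fun x => ∫ s in a..clamp a b x, (g : ℝ → E) (proj T s))
    ((intervalIntegral.continuous_primitive (RdContinuousOn.intervalIntegrable hT g.2) a).comp
      continuous_clamp)
    ((RdContinuousOn.exists_bound hT g.2).choose * (b - a)) fun x => by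
      refine (hT.norm_integral_le le_rfl le_clamp
        (RdContinuousOn.exists_bound hT g.2).choose_spec).trans ?_
      have h0 := (norm_nonneg _).trans
        ((RdContinuousOn.exists_bound hT g.2).choose_spec a hT.left_mem)
      gcongr
      rw [abs_of_nonneg (sub_nonneg.2 le_clamp)]
      exact sub_le_sub_right (clamp_le hT.lt.le) _
  map_add' g h := by
    ext x
    exact intervalIntegral.integral_add (RdContinuousOn.intervalIntegrable hT g.2 _ _)
      (RdContinuousOn.intervalIntegrable hT h.2 _ _)
  map_smul' c g := by
    ext x
    exact intervalIntegral.integral_smul c _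

theorem primitive_apply (hT : IsTimeScaleOn T a b) (g : rdSubmodule T E) (x : ℝ) :
    primitive hT E g x = ∫ s in a..clamp a b x, (g : ℝ → E) (proj T s) := rfl

theorem primitive_left (hT : IsTimeScaleOn T a b) (g : rdSubmodule T E) :
    primitive hT E g a = 0 := by
  rw [primitive_apply, hT.clamp_eq hT.left_mem, intervalIntegral.integral_same]

theorem norm_primitive_le (hT : IsTimeScaleOn T a b) (g : rdSubmodule T E) {C : ℝ}
    (hC : ∀ t ∈ T, ‖(g : ℝ → E) t‖ ≤ C) : ‖primitive hT E g‖ ≤ C * (b - a) := by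
  have h0 := (norm_nonneg _).trans (hC a hT.left_mem)
  refine (norm_le (mul_nonneg h0 (sub_nonneg.2 hT.lt.le))).2 fun x => ?_
  rw [primitive_apply]
  refine (hT.norm_integral_le le_rfl le_clamp hC).trans ?_
  gcongr
  rw [abs_of_nonneg (sub_nonneg.2 le_clamp)]
  exact sub_le_sub_right (clamp_le hT.lt.le) _

/-- Fundamental theorem of calculus for rd-continuous functions. -/
theorem hasDeltaDeriv_primitive [CompleteSpace E] (hT : IsTimeScaleOn T a b)
    (g : rdSubmodule T E) (ht : t ∈ T) :
    HasDeltaDeriv T (primitive hT E g) ((g : ℝ → E) t) t := by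
  have hg : RdContinuousOn T T (g : ℝ → E) := g.2
  have hint := hg.intervalIntegrable hT
  have hsub : ∀ s ∈ T, ∀ r ∈ T, primitive hT E g r - primitive hT E g s - (r - s) • (g : ℝ → E) t
      = ∫ x in s..r, ((g : ℝ → E) (proj T x) - (g : ℝ → E) t) := by
    intro s hs r hr
    rw [primitive_apply, primitive_apply, hT.clamp_eq hs, hT.clamp_eq hr,
      intervalIntegral.integral_interval_sub_left (hint _ _) (hint _ _),
      intervalIntegral.integral_sub (hint _ _) intervalIntegrable_const,
      intervalIntegral.integral_const]
  have htb := hT.isGreatest.2 ht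
  have hat := hT.isLeast.2 ht
  have hσ := hT.sigma_mem htb
  intro ε hε
  by_cases h : sigma T t = t
  · obtain ⟨δ, hδ, H⟩ := Metric.continuousWithinAt_iff.1 ((hg t ht).1 h) ε hε
    refine ⟨δ, hδ, fun s hs hst => ?_⟩
    rw [hsub s hs _ hσ, h]
    refine intervalIntegral.norm_integral_le_of_norm_le_const fun x hx => ?_
    have has := hT.isLeast.2 hs
    have hx' := uIoc_subset_uIcc hx
    have hax : a ≤ x := (le_min has hat).trans hx'.1
    rw [← dist_eq_norm]
    refine (H (hT.proj_mem hax) ?_).le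
    rw [Real.dist_eq]
    refine lt_of_le_of_lt (abs_sub_left_of_mem_uIcc (a := t) (b := s) ?_) hst
    rw [uIcc_comm]
    rcases le_total s t with hst' | hst'
    · rw [uIcc_of_le hst'] at hx' ⊢
      exact ⟨le_proj hs hx'.1, (hT.proj_le hax).trans hx'.2⟩
    · rw [uIcc_of_ge hst'] at hx' ⊢
      exact ⟨le_proj ht hx'.1, (hT.proj_le hax).trans hx'.2⟩
  · have hlt := lt_of_le_of_ne (hT.le_sigma htb) (Ne.symm h)
    obtain ⟨C, hC⟩ := hg.exists_bound hT
    have hC0 := (norm_nonneg _).trans (hC t ht)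
    have hm : 0 < sigma T t - t := sub_pos.2 hlt
    -- The first bound forces `s ≤ t`. The integrand vanishes on `[t, σ(t))`, and the integral from
    -- `s` to `t` is at most `2C|s - t|`, which the second bound keeps below `ε μ(t)`; the `+ 1`
    -- avoids division by zero.
    refine ⟨min (sigma T t - t) (ε * (sigma T t - t) / (2 * C + 1)), by positivity,
      fun s hs hst => ?_⟩
    rw [lt_min_iff] at hst
    have hst' : s ≤ t := by
      by_contra! h'
      have := sigma_le hs h'
      rw [abs_of_pos (sub_pos.2 h')] at hst
      linarith [hst.1]
    have hzero : ∫ x in t..sigma T t, ((g : ℝ → E) (proj T x) - (g : ℝ → E) t) = 0 := by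
      rw [intervalIntegral.integral_congr_Ioo_of_le hlt.le (g := fun _ => (0 : E)),
        intervalIntegral.integral_zero]
      intro x hx
      simp only [hT.proj_eq_of_mem_Ico ht ⟨hx.1.le, hx.2⟩, sub_self]
    rw [hsub s hs _ hσ, ← intervalIntegral.integral_add_adjacent_intervals
      ((hint s t).sub intervalIntegrable_const) ((hint t _).sub intervalIntegrable_const), hzero,
      add_zero]
    have := hT.norm_integral_le (g := fun x => (g : ℝ → E) x - (g : ℝ → E) t) (C := 2 * C)
      (hT.isLeast.2 hs) hat fun r hr => (norm_sub_le _ _).trans (by linarith [hC r hr, hC t ht])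
    refine this.trans ?_
    rw [abs_sub_comm]
    have h1 : 2 * C * |s - t| ≤ ε * (sigma T t - t) := by
      have := hst.2.le
      rw [le_div_iff₀ (by positivity)] at this
      nlinarith [abs_nonneg (s - t)]
    refine h1.trans ?_
    gcongr
    exact (sub_le_sub_left hst' _).trans (le_abs_self _)

/-- A nonnegative rd-continuous function with vanishing integral vanishes on `T^k`. -/
theorem eq_zero_of_primitive_eq_zero (hT : IsTimeScaleOn T a b) (g : rdSubmodule T ℝ)
    (hg : ∀ t ∈ T, 0 ≤ (g : ℝ → ℝ) t) (h0 : primitive hT ℝ g b = 0) (ht : t ∈ kappa T b) :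
    (g : ℝ → ℝ) t = 0 := by
  have hint := RdContinuousOn.intervalIntegrable hT g.2
  -- Nonnegativity forces all partial integrals to vanish, so `g` and `0` are both delta derivatives
  -- of the primitive.
  have hz : ∀ s ∈ T, primitive hT ℝ g s = 0 := by
    intro s hs
    have h1 : 0 ≤ ∫ x in a..s, (g : ℝ → ℝ) (proj T x) :=
      intervalIntegral.integral_nonneg (hT.isLeast.2 hs) fun x hx => hg _ (hT.proj_mem hx.1)
    have h2 : 0 ≤ ∫ x in s..b, (g : ℝ → ℝ) (proj T x) :=
      intervalIntegral.integral_nonneg (hT.isGreatest.2 hs) fun x hx =>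
        hg _ (hT.proj_mem ((hT.isLeast.2 hs).trans hx.1))
    rw [primitive_apply, hT.clamp_eq hT.right_mem,
      ← intervalIntegral.integral_add_adjacent_intervals (hint a s) (hint s b)] at h0
    rw [primitive_apply, hT.clamp_eq hs]
    linarith
  exact HasDeltaDeriv.unique hT ht (hasDeltaDeriv_primitive hT g ht.1)
    ((hasDeltaDeriv_const 0).congr hz (hT.sigma_mem (hT.isGreatest.2 ht.1)))

end Integral

/-! ### Volterra operators -/

section Volterra

variable {E : Type*} [NormedAddCommGroup E] [NormedSpace ℝ E] [CompleteSpace E]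

/-- A bounded operator on continuous functions with iterates of factorial decay can be subtracted
from the identity. -/
theorem isUnit_one_sub_of_volterra (K : (ℝ →ᵇ E) →L[ℝ] (ℝ →ᵇ E)) {M ℓ : ℝ} (hM : 0 ≤ M)
    (τ : ℝ → ℝ) (hτ : ∀ x, 0 ≤ τ x) (hτℓ : ∀ x, τ x ≤ ℓ)
    (hK : ∀ (η : ℝ →ᵇ E) (C : ℝ) (k : ℕ), 0 ≤ C → (∀ x, ‖η x‖ ≤ C * τ x ^ k) →
      ∀ x, ‖K η x‖ ≤ C * M / (k + 1) * τ x ^ (k + 1)) : IsUnit (1 - K) := by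
  have hpow : ∀ (k : ℕ) (η : ℝ →ᵇ E) (x : ℝ),
      ‖(K ^ k) η x‖ ≤ ‖η‖ * M ^ k / k.factorial * τ x ^ k := by
    intro k η
    induction k with
    | zero => intro x; simpa using η.norm_coe_le_norm x
    | succ k ih =>
      intro x
      rw [pow_succ', mul_apply_eq_comp]
      refine (hK _ _ k (by positivity) ih x).trans_eq ?_
      rw [Nat.factorial_succ]
      push_cast
      field_simp
      ring
  have hℓ : 0 ≤ ℓ := (hτ 0).trans (hτℓ 0)
  have hn : ∀ k : ℕ, ‖K ^ k‖ ≤ (M * ℓ) ^ k / k.factorial := by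
    intro k
    refine ContinuousLinearMap.opNorm_le_bound _ (by positivity) fun η => ?_
    refine (norm_le (by positivity)).2 fun x => (hpow k η x).trans ?_
    have := pow_le_pow_left₀ (hτ x) (hτℓ x) k
    calc ‖η‖ * M ^ k / k.factorial * τ x ^ k ≤ ‖η‖ * M ^ k / k.factorial * ℓ ^ k := by gcongr
      _ = _ := by rw [mul_pow]; ring
  obtain ⟨k, hk⟩ := ((FloorSemiring.tendsto_pow_div_factorial_atTop (M * ℓ)).eventually
    (gt_mem_nhds one_pos)).exists
  -- `1 - K` divides this unit, with the geometric sum as a commuting cofactor.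
  have hu : IsUnit (1 - K ^ k) := isUnit_one_sub_of_norm_lt_one ((hn k).trans_lt hk)
  rw [← mul_neg_geom_sum] at hu
  have hcomm : Commute (1 - K) (∑ i ∈ Finset.range k, K ^ i) :=
    ((Commute.one_left _).sub_left (Commute.sum_right _ _ _ fun i _ => Commute.self_pow K i))
  exact (hcomm.isUnit_mul_iff.1 hu).1

end Volterra

/-! ### Linear dynamic equations -/

section Linear

variable {E U : Type*} [NormedAddCommGroup E] [NormedSpace ℝ E] [NormedAddCommGroup U]
  [NormedSpace ℝ U] {T : Set ℝ} {a b t x : ℝ}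

theorem continuous_primitive_comp (hT : IsTimeScaleOn T a b)
    (N : (ℝ →ᵇ E) →ₗ[ℝ] rdSubmodule T E) {M : ℝ}
    (hN : ∀ (η : ℝ →ᵇ E) (t : ℝ), t ∈ T → ‖(N η : ℝ → E) t‖ ≤ M * ‖η‖) :
    Continuous (primitive hT E ∘ₗ N) :=
  AddMonoidHomClass.continuous_of_bound _ (M * (b - a)) fun η =>
    (norm_primitive_le hT (N η) (hN η)).trans_eq (by ring)

/-- Solvability of `η(x) - ∫_a^x (N η)(t) Δt = h(x)`. -/
theorem exists_isUnit_forward [CompleteSpace E] (hT : IsTimeScaleOn T a b)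
    (N : (ℝ →ᵇ E) →ₗ[ℝ] rdSubmodule T E) {M : ℝ} (hM : 0 ≤ M)
    (hN : ∀ (η : ℝ →ᵇ E) (t : ℝ), t ∈ T → ‖(N η : ℝ → E) t‖ ≤ M * ‖η t‖) :
    ∃ K : (ℝ →ᵇ E) →L[ℝ] (ℝ →ᵇ E), (∀ η, K η = primitive hT E (N η)) ∧ IsUnit (1 - K) := by
  refine ⟨⟨primitive hT E ∘ₗ N, continuous_primitive_comp hT N fun η t ht => (hN η t ht).trans
    (by gcongr; exact η.norm_coe_le_norm t)⟩, fun η => rfl, ?_⟩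
  refine isUnit_one_sub_of_volterra _ hM (ℓ := b - a) (fun x => clamp a b x - a)
    (fun x => sub_nonneg.2 le_clamp) (fun x => sub_le_sub_right (clamp_le hT.lt.le) _)
    fun η C k hC hη x => ?_
  change ‖primitive hT E (N η) x‖ ≤ _
  rw [primitive_apply]
  refine (intervalIntegral.norm_integral_le_of_norm_le le_clamp (g := fun s => C * M * (s - a) ^ k)
    (Eventually.of_forall fun s hs => ?_)
    (Continuous.intervalIntegrable (by fun_prop) _ _)).trans_eq ?_
  · have hp := hT.proj_mem hs.1.le
    have h0 := hT.isLeast.2 hp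
    have h1 := hη (proj T s)
    rw [hT.clamp_eq hp] at h1
    calc _ ≤ M * ‖η (proj T s)‖ := hN η _ hp
      _ ≤ M * (C * (proj T s - a) ^ k) := by gcongr
      _ ≤ M * (C * (s - a) ^ k) := by
        gcongr
        exact hT.proj_le hs.1.le
      _ = _ := by ring
  · rw [intervalIntegral.integral_const_mul,
      intervalIntegral.integral_comp_sub_right (fun s => s ^ k) a, integral_pow]
    simp
    ring

/-- The embedding of the constants into the bounded continuous functions. -/
noncomputable def constCLM (E : Type*) [NormedAddCommGroup E] [NormedSpace ℝ E] :
    E →L[ℝ] (ℝ →ᵇ E) :=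
  LinearMap.mkContinuous
    { toFun := BoundedContinuousFunction.const ℝ
      map_add' := fun _ _ => rfl
      map_smul' := fun _ _ => rfl } 1 fun c => by
    rw [one_mul]
    exact BoundedContinuousFunction.norm_const_le c

/-- Solvability of `p(x) - ∫_x^b (N p)(t) Δt = h(x)`, where `(N p)(t)` depends on `p(σ(t))`. -/
theorem exists_isUnit_backward [CompleteSpace E] (hT : IsTimeScaleOn T a b)
    (N : (ℝ →ᵇ E) →ₗ[ℝ] rdSubmodule T E) {M : ℝ} (hM : 0 ≤ M)
    (hN : ∀ (η : ℝ →ᵇ E) (t : ℝ), t ∈ T → ‖(N η : ℝ → E) t‖ ≤ M * ‖η (sigma T t)‖) :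
    ∃ K : (ℝ →ᵇ E) →L[ℝ] (ℝ →ᵇ E),
      (∀ η x, K η x = primitive hT E (N η) b - primitive hT E (N η) x) ∧ IsUnit (1 - K) := by
  set P : (ℝ →ᵇ E) →L[ℝ] (ℝ →ᵇ E) := ⟨primitive hT E ∘ₗ N,
    continuous_primitive_comp hT N fun η t ht => (hN η t ht).trans
      (by gcongr; exact η.norm_coe_le_norm _)⟩
  have hP : ∀ η, P η = primitive hT E (N η) := fun η => rfl
  refine ⟨constCLM E ∘L BoundedContinuousFunction.evalCLM ℝ b ∘L P - P,
    fun η x => rfl, ?_⟩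
  refine isUnit_one_sub_of_volterra _ hM (ℓ := b - a) (fun x => b - clamp a b x)
    (fun x => sub_nonneg.2 (clamp_le hT.lt.le)) (fun x => sub_le_sub_left le_clamp _)
    fun η C k hC hη x => ?_
  change ‖primitive hT E (N η) b - primitive hT E (N η) x‖ ≤ _
  have hint := RdContinuousOn.intervalIntegrable hT (N η).2
  rw [primitive_apply, primitive_apply, hT.clamp_eq hT.right_mem,
    intervalIntegral.integral_interval_sub_left (hint _ _) (hint _ _)]
  -- The majorant is valid because `s ≤ σ(proj T s)`: it matters that the operator evaluates at `σ`.
  refine (intervalIntegral.norm_integral_le_of_norm_le (clamp_le hT.lt.le)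
    (g := fun s => C * M * (b - s) ^ k) (Eventually.of_forall fun s hs => ?_)
    (Continuous.intervalIntegrable (by fun_prop) _ _)).trans_eq ?_
  · have has : a ≤ s := le_clamp.trans hs.1.le
    have hp := hT.proj_mem has
    have hσ := hT.sigma_mem (hT.isGreatest.2 hp)
    have h0 := hT.isGreatest.2 hσ
    have h1 := hη (sigma T (proj T s))
    rw [hT.clamp_eq hσ] at h1
    calc _ ≤ M * ‖η (sigma T (proj T s))‖ := hN η _ hp
      _ ≤ M * (C * (b - sigma T (proj T s)) ^ k) := by gcongr
      _ ≤ M * (C * (b - s) ^ k) := by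
        gcongr
        exact hT.le_sigma_proj has hs.2
      _ = _ := by ring
  · rw [intervalIntegral.integral_const_mul,
      intervalIntegral.integral_comp_sub_left (fun s => s ^ k) b, integral_pow]
    simp
    ring

/-- The superposition operator `η ↦ D(·)(η, 0)`. -/
noncomputable def stateOp {D : ℝ → E × U →L[ℝ] E} (hD : RdContinuousOn T T D) :
    (ℝ →ᵇ E) →ₗ[ℝ] rdSubmodule T E where
  toFun η := ⟨fun t => D t (η t, 0), hD.clm_apply ((rdContinuousOn_of_continuousOn
    η.continuous.continuousOn).comp_continuous (g := fun y => (y, (0 : U))) (by fun_prop))⟩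
  map_add' η ξ := by
    ext t
    change D t (η t + ξ t, 0) = D t (η t, 0) + D t (ξ t, 0)
    rw [← map_add, Prod.mk_add_mk, add_zero]
  map_smul' c η := by
    ext t
    change D t ((c • η) t, 0) = c • D t (η t, 0)
    rw [← map_smul, Prod.smul_mk, smul_zero]
    rfl

/-- The superposition operator `v ↦ D(·)(0, v)`. -/
noncomputable def controlOp {D : ℝ → E × U →L[ℝ] E} (hD : RdContinuousOn T T D) :
    rdSubmodule T U →ₗ[ℝ] rdSubmodule T E where
  toFun v := ⟨fun t => D t (0, (v : ℝ → U) t), hD.clm_apply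
    (RdContinuousOn.comp_continuous v.2 (g := fun w => ((0 : E), w)) (by fun_prop))⟩
  map_add' v w := by
    ext t
    change D t (0, (v : ℝ → U) t + (w : ℝ → U) t) = D t (0, (v : ℝ → U) t) + D t (0, (w : ℝ → U) t)
    rw [← map_add, Prod.mk_add_mk, add_zero]
  map_smul' c v := by
    ext t
    change D t (0, c • (v : ℝ → U) t) = c • D t (0, (v : ℝ → U) t)
    rw [← map_smul, Prod.smul_mk, smul_zero]

/-- The composition operator `p ↦ p^σ ∘ D(·)(·, 0)`. -/
noncomputable def adjointOp {D : ℝ → E × U →L[ℝ] E} (hT : IsTimeScaleOn T a b)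
    (hD : RdContinuousOn T T D) : (ℝ →ᵇ (E →L[ℝ] ℝ)) →ₗ[ℝ] rdSubmodule T (E →L[ℝ] ℝ) where
  toFun p := ⟨fun t => (p (sigma T t)).comp ((D t).comp (ContinuousLinearMap.inl ℝ E U)),
    (hT.rdContinuousOn_comp_sigma p.continuous.continuousOn).clm_comp
      (hD.comp_continuous (g := fun A => A.comp (ContinuousLinearMap.inl ℝ E U)) (by fun_prop))⟩
  map_add' p q := by
    ext t
    rfl
  map_smul' c p := by
    ext t
    rfl

/-- The linearized system is either controllable or has a nontrivial costate annihilating the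
controls. -/
theorem controllable_or_exists_costate [FiniteDimensional ℝ E] (hT : IsTimeScaleOn T a b)
    {D : ℝ → E × U →L[ℝ] E} (hD : RdContinuousOn T T D) :
    (∃ R : E →ₗ[ℝ] rdSubmodule T U, ∀ (h : ℝ →ᵇ E) (w : E), ∃ (η : ℝ →ᵇ E) (e : E),
      η - primitive hT E (stateOp hD η + controlOp hD (R e)) = h ∧ η b = w) ∨
    ∃ p : ℝ → E →L[ℝ] ℝ, p b ≠ 0 ∧
      (∀ t ∈ kappa T b, HasDeltaDeriv T p
        (-(p (sigma T t)).comp ((D t).comp (ContinuousLinearMap.inl ℝ E U))) t) ∧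
      ∀ t ∈ kappa T b, ∀ w : U, p (sigma T t) (D t (0, w)) = 0 := by
  have : CompleteSpace E := FiniteDimensional.complete ℝ E
  obtain ⟨M, hM⟩ := hD.exists_bound hT
  have hM0 : 0 ≤ M := (norm_nonneg _).trans (hM a hT.left_mem)
  obtain ⟨K, hK, hKu⟩ := exists_isUnit_forward hT (stateOp hD) hM0 fun η t ht => by
    refine ((D t).le_opNorm _).trans ?_
    have : ‖(η t, (0 : U))‖ = ‖η t‖ := by simp [Prod.norm_def]
    rw [this]
    gcongr
    exact hM t ht
  obtain ⟨V, hV⟩ := hKu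
  set S : (ℝ →ᵇ E) →L[ℝ] (ℝ →ᵇ E) := V⁻¹.val
  have hS : ∀ h, S h - primitive hT E (stateOp hD (S h)) = h := fun h => by
    have : ((V : (ℝ →ᵇ E) →L[ℝ] (ℝ →ᵇ E)) * S) h = h := by simp [S]
    rw [hV] at this
    rw [← hK]
    exact this
  -- `Λ` sends a control variation to the endpoint of the linearized trajectory that starts at `0`.
  set Λ : rdSubmodule T U →ₗ[ℝ] E :=
    (BoundedContinuousFunction.evalCLM ℝ b ∘L S).toLinearMap ∘ₗ primitive hT E ∘ₗ controlOp hD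
    with hΛ
  by_cases hsurj : Λ.range = ⊤
  · left
    obtain ⟨R, hR⟩ := Λ.exists_rightInverse_of_surjective hsurj
    -- Solve without control first, then let the right inverse of `Λ` correct the endpoint defect `w
    -- - S h b`.
    refine ⟨R, fun h w => ⟨S h + S (primitive hT E (controlOp hD (R (w - S h b)))), w - S h b,
      ?_, ?_⟩⟩
    · have h1 := hS h
      have h2 := hS (primitive hT E (controlOp hD (R (w - S h b))))
      set v := primitive hT E (controlOp hD (R (w - S h b)))
      rw [map_add, map_add, map_add]
      calc _ = (S h - primitive hT E (stateOp hD (S h)))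
            + (S v - primitive hT E (stateOp hD (S v))) - v := by
              simp only [v]; abel
        _ = h := by rw [h1, h2, add_sub_cancel_right]
    · have : Λ (R (w - S h b)) = w - S h b := LinearMap.congr_fun hR _
      change S h b + Λ (R (w - S h b)) = w
      rw [this, add_sub_cancel]
  · right
    obtain ⟨l, hl0, hl⟩ := Submodule.exists_le_ker_of_lt_top _ (lt_top_iff_ne_top.2 hsurj)
    set lc : E →L[ℝ] ℝ := LinearMap.toContinuousLinearMap l
    obtain ⟨K', hK', V', hV'⟩ := exists_isUnit_backward hT (adjointOp hT hD) hM0 fun p t ht => by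
      change ‖(p (sigma T t)).comp ((D t).comp (ContinuousLinearMap.inl ℝ E U))‖ ≤ _
      refine (ContinuousLinearMap.opNorm_comp_le _ _).trans ?_
      rw [mul_comm]
      gcongr
      refine (ContinuousLinearMap.opNorm_comp_le _ _).trans ?_
      calc _ ≤ ‖D t‖ * 1 := by gcongr; exact ContinuousLinearMap.norm_inl_le_one ℝ E U
        _ ≤ M := by rw [mul_one]; exact hM t ht
    set p : ℝ →ᵇ (E →L[ℝ] ℝ) :=
      V'⁻¹.val (BoundedContinuousFunction.const ℝ lc)
    have hp : ∀ x, p x = lc + (primitive hT _ (adjointOp hT hD p) b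
        - primitive hT _ (adjointOp hT hD p) x) := fun x => by
      have : (V'.val * V'⁻¹.val)
        (BoundedContinuousFunction.const ℝ lc) = BoundedContinuousFunction.const ℝ lc := by simp
      rw [hV'] at this
      have h1 : p - K' p = BoundedContinuousFunction.const ℝ lc := this
      have h2 := DFunLike.congr_fun h1 x
      rw [← hK']
      exact sub_eq_iff_eq_add.1 h2
    have hpb : p b = lc := by rw [hp, sub_self, add_zero]
    have hpd : ∀ t ∈ T, HasDeltaDeriv T p
        (-(p (sigma T t)).comp ((D t).comp (ContinuousLinearMap.inl ℝ E U))) t := fun t ht => by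
      have h1 := hasDeltaDeriv_primitive hT (adjointOp hT hD p) ht
      have h2 := (hasDeltaDeriv_const (T := T) (t := t)
        (lc + primitive hT _ (adjointOp hT hD p) b)).sub h1
      rw [zero_sub] at h2
      exact h2.congr (fun s _ => by rw [hp s]; abel) (hT.sigma_mem (hT.isGreatest.2 ht))
    refine ⟨p, ?_, fun t ht => hpd t ht.1, fun t ht w => ?_⟩
    · rw [hpb]
      intro h0
      exact hl0 (LinearMap.toContinuousLinearMap.injective (h0.trans (map_zero _).symm))
    -- Test with the control `c w`. By the product rule `p(η)` has delta derivative `c²`; it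
    -- vanishes at `a` since `η(a) = 0`, and at `b` since `l` kills the range of `Λ`. Hence `c²` has
    -- integral zero.
    · set c : ℝ → ℝ := fun s => p (sigma T s) (D s (0, w)) with hc_def
      have hc : RdContinuousOn T T c :=
        (hT.rdContinuousOn_comp_sigma p.continuous.continuousOn).clm_apply
          (hD.comp_continuous (g := fun A => A ((0 : E), w)) (by fun_prop))
      set v : rdSubmodule T U :=
        ⟨fun s => c s • w, hc.comp_continuous (g := fun r => r • w) (by fun_prop)⟩
      set g : rdSubmodule T ℝ := ⟨fun s => c s * c s, hc.comp_continuous (g := fun r => r * r)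
        (by fun_prop)⟩
      set η := S (primitive hT E (controlOp hD v)) with hη_def
      have hη : η = primitive hT E (stateOp hD η + controlOp hD v) := by
        rw [map_add, ← sub_eq_iff_eq_add']
        exact hS _
      have hηd : ∀ s ∈ T, HasDeltaDeriv T η (D s (η s, 0) + D s (0, c s • w)) s := fun s hs => by
        have := hasDeltaDeriv_primitive hT (stateOp hD η + controlOp hD v) hs
        rw [← hη] at this
        exact this
      have hq : ∀ s ∈ kappa T b, HasDeltaDeriv T (fun r => p r (η r)) (c s * c s) s :=
        fun s hs => by
          have := (hpd s hs.1).clm_apply (hηd s hs.1) hs.1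
          convert this using 1
          have e : D s (0, c s • w) = c s • D s (0, w) := by
            rw [← map_smul, Prod.smul_mk, smul_zero]
          rw [e, map_add, map_smul]
          simp [hc_def]
      have hηa : η a = 0 := by rw [hη, primitive_left]
      have hηb : p b (η b) = 0 := by
        rw [hpb]
        exact hl ⟨v, rfl⟩
      have hgb : primitive hT ℝ g b = 0 := by
        rw [← hηb]
        exact hT.eq_of_hasDeltaDeriv (f := primitive hT ℝ g) (g := fun r => p r (η r))
          (h := fun s => c s * c s)
          (fun s hs => hasDeltaDeriv_primitive hT g hs.1) hq
          (by rw [primitive_left, hηa, map_zero]) b hT.right_mem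
      exact mul_self_eq_zero.1
        (eq_zero_of_primitive_eq_zero hT g (fun s _ => mul_self_nonneg _) hgb ht)

end Linear

/-! ### Local controllability of nonlinear dynamic equations -/

section Nonlinear

variable {E U : Type*} [NormedAddCommGroup E] [NormedSpace ℝ E] [NormedAddCommGroup U]
  [NormedSpace ℝ U] {T : Set ℝ} {a b : ℝ}

/-- A linear map from a finite-dimensional space into the rd-continuous functions is bounded. -/
theorem exists_bound_linearMap [FiniteDimensional ℝ E] (hT : IsTimeScaleOn T a b)
    (R : E →ₗ[ℝ] rdSubmodule T U) :
    ∃ C, 0 ≤ C ∧ ∀ e, ∀ t ∈ T, ‖(R e : ℝ → U) t‖ ≤ C * ‖e‖ := by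
  have : CompleteSpace E := FiniteDimensional.complete ℝ E
  let g : T → E →L[ℝ] U := fun t => LinearMap.toContinuousLinearMap
    ((LinearMap.proj (t : ℝ) : (ℝ → U) →ₗ[ℝ] U) ∘ₗ (rdSubmodule T U).subtype ∘ₗ R)
  -- Each `R e` is bounded on `T`; uniform boundedness over `t ∈ T` gives one constant.
  obtain ⟨C, hC⟩ := banach_steinhaus (g := g) fun e => by
    obtain ⟨C, hC⟩ := RdContinuousOn.exists_bound hT (R e).2
    exact ⟨C, fun t => hC t t.2⟩
  refine ⟨C, (norm_nonneg _).trans (hC ⟨a, hT.left_mem⟩), fun e t ht => ?_⟩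
  exact (g ⟨t, ht⟩).le_of_opNorm_le (hC ⟨t, ht⟩) e

/-- If the linearization along a trajectory is controllable (in the sense that `R` parametrizes
sufficiently many controls), the endpoints of nearby trajectories fill a neighborhood. -/
theorem eventually_exists_trajectory [FiniteDimensional ℝ E] (hT : IsTimeScaleOn T a b)
    {f : ℝ → E × U → E} (hf₁ : ∀ t ∈ T, ContDiff ℝ 1 (f t)) (hf : RdContinuousFamily T f)
    (hf' : RdContinuousFamily T (fun t => fderiv ℝ (f t))) {z : ℝ → E} {u : ℝ → U}
    (hz : ∀ t ∈ kappa T b, HasDeltaDeriv T z (f t (z t, u t)) t) (hu : RdContinuousOn T T u)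
    (hD : RdContinuousOn T T (fun t => fderiv ℝ (f t) (z t, u t)))
    (R : E →ₗ[ℝ] rdSubmodule T U)
    (hR : ∀ (h : ℝ →ᵇ E) (w : E), ∃ (η : ℝ →ᵇ E) (e : E),
      η - primitive hT E (stateOp hD η + controlOp hD (R e)) = h ∧ η b = w)
    {ε : ℝ} (hε : 0 < ε) :
    ∀ᶠ w in 𝓝 (z b), ∃ (z' : ℝ → E) (u' : ℝ → U), RdContinuousOn T T u' ∧
      (∀ t ∈ T, HasDeltaDeriv T z' (f t (z' t, u' t)) t) ∧ z' a = z a ∧ z' b = w ∧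
      ∀ t ∈ T, ‖(z' t, u' t) - (z t, u t)‖ < ε := by
  have : CompleteSpace E := FiniteDimensional.complete ℝ E
  have hzc : ContinuousOn z T := hT.continuousOn_of_hasDeltaDeriv hz
  have hzu : RdContinuousOn T T (fun t => (z t, u t)) :=
    (rdContinuousOn_of_continuousOn hzc).prodMk hu
  obtain ⟨C, hC0, hC⟩ := exists_bound_linearMap hT R
  obtain ⟨M, hM⟩ := hD.exists_bound hT
  have hM0 : 0 ≤ M := (norm_nonneg _).trans (hM a hT.left_mem)
  have hba : 0 < b - a := sub_pos.2 hT.lt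
  have hC1 : 0 < 1 + C := by positivity
  -- The unknowns are a trajectory and a finite-dimensional control parameter, which form a Banach
  -- space.
  set X := (ℝ →ᵇ E) × E
  let pt : X → ℝ → E × U := fun x t => (x.1 t, u t + (R x.2 : ℝ → U) t)
  have hpt : ∀ x, RdContinuousOn T T (pt x) := fun x =>
    (rdContinuousOn_of_continuousOn x.1.continuous.continuousOn).prodMk (hu.add (R x.2).2)
  have hpt_sub : ∀ x y t, pt x t - pt y t = ((x - y).1 t, (R (x - y).2 : ℝ → U) t) := by
    intro x y t
    refine Prod.ext rfl ?_
    change u t + (R x.2 : ℝ → U) t - (u t + (R y.2 : ℝ → U) t) = (R (x.2 - y.2) : ℝ → U) t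
    rw [map_sub, add_sub_add_left_eq_sub]
    rfl
  have hnorm : ∀ x : X, ∀ t ∈ T, ‖(x.1 t, (R x.2 : ℝ → U) t)‖ ≤ (1 + C) * ‖x‖ := by
    intro x t ht
    refine max_le ?_ ?_
    · have := (x.1.norm_coe_le_norm t).trans (norm_fst_le x)
      nlinarith [mul_nonneg hC0 (norm_nonneg x)]
    · have := mul_le_mul_of_nonneg_left (norm_snd_le x) hC0
      have := hC x.2 t ht
      change ‖(R x.2 : ℝ → U) t‖ ≤ _
      linarith [norm_nonneg x]
  let N : X → (ℝ →ᵇ E) := fun x => primitive hT E ⟨fun t => f t (pt x t), hf.comp (hpt x)⟩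
  let N' : X →L[ℝ] (ℝ →ᵇ E) := LinearMap.mkContinuous
    (primitive hT E ∘ₗ (stateOp hD ∘ₗ LinearMap.fst ℝ _ _
      + controlOp hD ∘ₗ R ∘ₗ LinearMap.snd ℝ _ _)) (M * (1 + C) * (b - a)) fun x => by
    refine (norm_primitive_le hT _ (C := M * (1 + C) * ‖x‖) fun t ht => ?_).trans_eq (by ring)
    change ‖fderiv ℝ (f t) (z t, u t) (x.1 t, 0)
      + fderiv ℝ (f t) (z t, u t) (0, (R x.2 : ℝ → U) t)‖ ≤ _
    rw [← map_add, Prod.mk_add_mk, add_zero, zero_add, mul_assoc]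
    exact ContinuousLinearMap.le_of_opNorm_le_of_le _ (hM t ht) (hnorm x t ht)
  have hN' : ∀ x, N' x = primitive hT E (stateOp hD x.1 + controlOp hD (R x.2)) := fun x => rfl
  -- Only the values of `z` on `T` are controlled; `ζ` agrees with them and is bounded and
  -- continuous on the line.
  let ζ : ℝ →ᵇ E := BoundedContinuousFunction.const ℝ (z a)
    + primitive hT E ⟨fun t => f t (z t, u t), hf.comp hzu⟩
  have hζ : ∀ t ∈ T, ζ t = z t := fun t ht => by
    have h := hT.eq_of_hasDeltaDeriv (f := fun s => z s - z a) (h := fun s => f s (z s, u s))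
      (fun s hs => by simpa using (hz s hs).sub (hasDeltaDeriv_const (z a)))
      (fun s hs => hasDeltaDeriv_primitive hT ⟨_, hf.comp hzu⟩ hs.1)
      (by rw [sub_self, primitive_left]) t ht
    change z a + primitive hT E ⟨fun t => f t (z t, u t), hf.comp hzu⟩ t = z t
    rw [← h, add_sub_cancel]
  have hpt₀ : ∀ t ∈ T, pt (ζ, 0) t = (z t, u t) := fun t ht => by simp [pt, hζ t ht]
  have hclose : ∀ (δ : ℝ) (x : X), ‖x - (ζ, 0)‖ < δ / (1 + C) → ∀ t ∈ T,
      ‖pt x t - (z t, u t)‖ < δ := fun δ x hx t ht => by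
    rw [← hpt₀ t ht, hpt_sub]
    refine (hnorm _ t ht).trans_lt ?_
    rwa [lt_div_iff₀ hC1, mul_comm] at hx
  have hstrict : HasStrictFDerivAt N N' ((ζ, 0) : X) := by
    refine .of_isLittleO (Asymptotics.isLittleO_iff.2 fun c hc => ?_)
    -- The mean value inequality is applied at each `t` with a radius independent of `t`. The
    -- denominators absorb the factor `1 + C` of `hnorm` and the factor `b - a` from integration.
    obtain ⟨δ, hδ, H⟩ := hf'.exists_delta hT
      (fun t ht => (hf₁ t ht).continuous_fderiv one_ne_zero) hzu
      (ε := c / ((1 + C) * (b - a))) (by positivity)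
    have hb := Metric.ball_mem_nhds ((ζ, 0) : X) (div_pos hδ hC1)
    filter_upwards [prod_mem_nhds hb hb] with ⟨x, y⟩ hxy
    obtain ⟨hx, hy⟩ := hxy
    replace hx := mem_ball_iff_norm.1 hx
    replace hy := mem_ball_iff_norm.1 hy
    have e : N x - N y - N' (x - y) = primitive hT E
        ((⟨fun t => f t (pt x t), hf.comp (hpt x)⟩ : rdSubmodule T E)
          - ⟨fun t => f t (pt y t), hf.comp (hpt y)⟩
          - (stateOp hD (x - y).1 + controlOp hD (R (x - y).2))) := by
      rw [hN', map_sub, map_sub]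
    change ‖N x - N y - N' (x - y)‖ ≤ c * ‖x - y‖
    rw [e]
    refine (norm_primitive_le hT _ (C := c / (b - a) * ‖x - y‖) fun t ht => ?_).trans_eq
      (by field_simp)
    change ‖f t (pt x t) - f t (pt y t) - (fderiv ℝ (f t) (z t, u t) ((x - y).1 t, 0)
      + fderiv ℝ (f t) (z t, u t) (0, (R (x - y).2 : ℝ → U) t))‖ ≤ _
    rw [← map_add, Prod.mk_add_mk, add_zero, zero_add, ← hpt_sub]
    have hmv := (convex_ball (z t, u t) δ).norm_image_sub_le_of_norm_hasFDerivWithin_le'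
      (f := f t) (f' := fderiv ℝ (f t)) (φ := fderiv ℝ (f t) (z t, u t))
      (x := pt y t) (y := pt x t)
      (fun w _ => (((hf₁ t ht).differentiable one_ne_zero) w).hasFDerivAt.hasFDerivWithinAt)
      (fun w hw => H t ht w (mem_ball_iff_norm.1 hw))
      (mem_ball_iff_norm.2 (hclose δ y hy t ht)) (mem_ball_iff_norm.2 (hclose δ x hx t ht))
    refine hmv.trans ?_
    rw [hpt_sub]
    calc _ ≤ c / ((1 + C) * (b - a)) * ((1 + C) * ‖x - y‖) := by
          gcongr
          exact hnorm _ t ht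
      _ = _ := by field_simp
  -- The first component vanishes exactly for solutions of the integral equation starting at `z a`;
  -- the second is the endpoint. `hR` is surjectivity of the derivative of `Φ` at `(ζ, 0)`.
  let Φ : X → (ℝ →ᵇ E) × E := fun x =>
    (x.1 - N x - BoundedContinuousFunction.const ℝ (z a), x.1 b)
  let ev : X →L[ℝ] E :=
    BoundedContinuousFunction.evalCLM ℝ b ∘L ContinuousLinearMap.fst ℝ (ℝ →ᵇ E) E
  have hΦ : HasStrictFDerivAt Φ
      ((ContinuousLinearMap.fst ℝ (ℝ →ᵇ E) E - N').prod ev) ((ζ, 0) : X) :=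
    ((hasStrictFDerivAt_fst.sub hstrict).sub_const _).prodMk ev.hasStrictFDerivAt
  have hsurj := hΦ.map_nhds_eq_of_surj (by
    rw [LinearMap.range_eq_top]
    rintro ⟨h, w⟩
    obtain ⟨η, e, h1, h2⟩ := hR h w
    exact ⟨(η, e), Prod.ext h1 h2⟩)
  have hΦ₀ : Φ (ζ, 0) = (0, z b) := by
    refine Prod.ext ?_ (hζ b hT.right_mem)
    have hN₀ : N (ζ, 0) = primitive hT E ⟨fun t => f t (z t, u t), hf.comp hzu⟩ := by
      ext s
      simp only [N, primitive_apply]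
      refine intervalIntegral.integral_congr fun r hr => ?_
      rw [uIcc_of_le le_clamp] at hr
      simp only [hpt₀ _ (hT.proj_mem hr.1)]
    change ζ - N (ζ, 0) - BoundedContinuousFunction.const ℝ (z a) = 0
    rw [hN₀]
    simp [ζ]
  have hnhds : Φ '' Metric.ball (ζ, 0) (ε / (1 + C)) ∈ 𝓝 ((0 : ℝ →ᵇ E), z b) := by
    rw [← hΦ₀, ← hsurj]
    exact image_mem_map (Metric.ball_mem_nhds _ (by positivity))
  have htend : Tendsto (fun w : E => ((0 : ℝ →ᵇ E), w)) (𝓝 (z b)) (𝓝 ((0 : ℝ →ᵇ E), z b)) :=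
    (Continuous.prodMk_right (0 : ℝ →ᵇ E)).tendsto _
  filter_upwards [htend hnhds] with w hw
  obtain ⟨x, hx, hxw⟩ := hw
  have h1 : x.1 - N x - BoundedContinuousFunction.const ℝ (z a) = 0 := congrArg Prod.fst hxw
  have h2 : x.1 b = w := congrArg Prod.snd hxw
  have h3 : ∀ s, x.1 s = z a + N x s := fun s => by
    have h4 : x.1 s - N x s - z a = 0 := DFunLike.congr_fun h1 s
    rw [sub_sub, sub_eq_zero] at h4
    rw [h4, add_comm]
  refine ⟨x.1, fun t => u t + (R x.2 : ℝ → U) t, hu.add (R x.2).2, fun t ht => ?_, ?_, h2,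
    hclose ε x (mem_ball_iff_norm.1 hx)⟩
  · have := (hasDeltaDeriv_primitive hT ⟨_, hf.comp (hpt x)⟩ ht).sub
      (hasDeltaDeriv_const (-(z a)))
    rw [sub_zero] at this
    exact this.congr (fun s _ => by rw [h3 s, sub_neg_eq_add, add_comm])
      (hT.sigma_mem (hT.isGreatest.2 ht))
  · rw [h3 a]
    change z a + primitive hT E _ a = z a
    rw [primitive_left, add_zero]

end Nonlinear

end Trajectories

/-! ### The Lagrange problem -/

/-! ### Operations on rd-continuous families -/

section Family

variable {E F : Type*} [NormedAddCommGroup E] [NormedAddCommGroup F] {T : Set ℝ}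
  {Z W : Type*} [TopologicalSpace Z] [TopologicalSpace W]

theorem RdContinuousFamily.prodMk {f : ℝ → Z → E} {g : ℝ → Z → F} (hf : RdContinuousFamily T f)
    (hg : RdContinuousFamily T g) : RdContinuousFamily T (fun t z => (f t z, g t z)) := by
  refine fun t ht z => ⟨fun h => ((hf t ht z).1 h).prodMk_nhds ((hg t ht z).1 h), fun h => ?_⟩
  obtain ⟨l, hl⟩ := (hf t ht z).2 h
  obtain ⟨k, hk⟩ := (hg t ht z).2 h
  exact ⟨(l, k), hl.prodMk_nhds hk⟩

theorem RdContinuousFamily.continuous_comp {f : ℝ → Z → E} (hf : RdContinuousFamily T f)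
    {g : E → F} (hg : Continuous g) : RdContinuousFamily T (fun t z => g (f t z)) := by
  refine fun t ht z => ⟨fun h => (hg.tendsto _).comp ((hf t ht z).1 h), fun h => ?_⟩
  obtain ⟨l, hl⟩ := (hf t ht z).2 h
  exact ⟨g l, (hg.tendsto l).comp hl⟩

theorem RdContinuousFamily.comp_continuous {f : ℝ → Z → E} (hf : RdContinuousFamily T f)
    {g : W → Z} (hg : Continuous g) : RdContinuousFamily T (fun t w => f t (g w)) := by
  intro t ht w
  have h : ∀ 𝓕 : Filter ℝ, Tendsto (fun p : ℝ × W => (p.1, g p.2)) (𝓕 ×ˢ 𝓝 w) (𝓕 ×ˢ 𝓝 (g w)) :=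
    fun 𝓕 => tendsto_id.prodMap (hg.tendsto w)
  exact ⟨fun hσ => ((hf t ht (g w)).1 hσ).comp (h _), fun hρ => ((hf t ht (g w)).2 hρ).imp
    fun _ hl => hl.comp (h _)⟩

theorem RdContinuousFamily.congr {f g : ℝ → Z → E} (hf : RdContinuousFamily T f)
    (h : ∀ t ∈ T, g t = f t) : RdContinuousFamily T g := by
  intro t ht z
  have hmem : ∀ S, S ⊆ T → ∀ᶠ p : ℝ × Z in 𝓝[S] t ×ˢ 𝓝 z, f p.1 p.2 = g p.1 p.2 := fun S hS =>
    tendsto_fst.eventually (eventually_mem_nhdsWithin (a := t) (s := S)) |>.mono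
      fun p hp => by rw [h p.1 (hS hp)]
  refine ⟨fun hσ => ?_, fun hρ => ((hf t ht z).2 hρ).imp fun _ hl =>
    hl.congr' (hmem _ inter_subset_left)⟩
  rw [h t ht]
  exact ((hf t ht z).1 hσ).congr' (hmem _ subset_rfl)

end Family

/-- The witness is `b` or, when `b` is left-scattered, `ρ(b)`. It turns `p(b) ≠ 0` into a statement
about `p^σ` on `T^k`. -/
theorem IsTimeScaleOn.exists_sigma_eq_right {T : Set ℝ} {a b : ℝ} (hT : IsTimeScaleOn T a b) :
    ∃ t ∈ kappa T b, sigma T t = b := by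
  by_cases hb : b ∈ kappa T b
  · exact ⟨b, hb, hT.sigma_right⟩
  have hlt : rho T b < b := by
    by_contra h
    exact hb ⟨hT.right_mem, fun h' => h h'.1⟩
  have hmem : rho T b ∈ T := by
    rw [rho, if_pos ⟨a, hT.left_mem, hT.lt⟩]
    exact hT.isClosed.closure_subset_iff.2 inter_subset_left
      (csSup_mem_closure (s := T ∩ Iio b) ⟨a, hT.left_mem, hT.lt⟩ bddAbove_inter_Iio)
  refine ⟨rho T b, mem_kappa_of_lt hmem hlt, (sigma_le hT.right_mem hlt).antisymm ?_⟩
  by_contra! h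
  have h1 := le_antisymm (le_rho (hT.sigma_mem hlt.le) h) (hT.le_sigma hlt.le)
  obtain ⟨s, hs, h2, h3⟩ := hT.exists_mem_Ioo hlt h1 hlt
  exact absurd (le_rho hs h3) (not_le.2 h2)

/-! ### The system extended by the cost, and its costate -/

section Lagrange

variable {n m : ℕ} {T : Set ℝ} {a b : ℝ}

/-- The projection `((y, c), u) ↦ (y, u)` forgetting the accumulated cost. -/
noncomputable def forgetCost (n m : ℕ) : (Vec n × ℝ) × Vec m →L[ℝ] Vec n × Vec m :=
  ((ContinuousLinearMap.fst ℝ (Vec n) ℝ).comp (ContinuousLinearMap.fst ℝ _ _)).prod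
    (ContinuousLinearMap.snd ℝ _ _)

/-- The right-hand side of the dynamics extended by the accumulated cost. -/
def extendedRhs (L : ℝ → Vec n → Vec m → ℝ) (φ : ℝ → Vec n → Vec m → Vec n) (t : ℝ)
    (w : (Vec n × ℝ) × Vec m) : Vec n × ℝ := (φ t w.1.1 w.2, L t w.1.1 w.2)

variable {L : ℝ → Vec n → Vec m → ℝ} {φ : ℝ → Vec n → Vec m → Vec n}

/-- Factoring through `forgetCost` shows that the derivative does not see the cost: it may be taken
at cost `0`, and it kills the cost direction. -/
theorem hasFDerivAt_extendedRhs (hL : IsRegularData T L) (hφ : IsRegularData T φ) {t : ℝ}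
    (ht : t ∈ T) (w : (Vec n × ℝ) × Vec m) :
    HasFDerivAt (extendedRhs L φ t)
      (((fderiv ℝ (fun z : Vec n × Vec m => φ t z.1 z.2) (forgetCost n m w)).prod
        (fderiv ℝ (fun z : Vec n × Vec m => L t z.1 z.2) (forgetCost n m w))).comp
          (forgetCost n m)) w := by
  have h1 := (((hφ.contDiff t ht).differentiable one_ne_zero) (forgetCost n m w)).hasFDerivAt
  have h2 := (((hL.contDiff t ht).differentiable one_ne_zero) (forgetCost n m w)).hasFDerivAt
  exact (h1.prodMk h2).comp w (forgetCost n m).hasFDerivAt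

theorem contDiff_extendedRhs (hL : IsRegularData T L) (hφ : IsRegularData T φ) {t : ℝ}
    (ht : t ∈ T) : ContDiff ℝ 1 (extendedRhs L φ t) :=
  ((hφ.contDiff t ht).prodMk (hL.contDiff t ht)).comp (forgetCost n m).contDiff

theorem rdContinuousFamily_extendedRhs (hL : IsRegularData T L) (hφ : IsRegularData T φ) :
    RdContinuousFamily T (extendedRhs L φ) :=
  (hφ.rdContinuous.prodMk hL.rdContinuous).comp_continuous (forgetCost n m).continuous

theorem rdContinuousFamily_fderiv_extendedRhs (hL : IsRegularData T L) (hφ : IsRegularData T φ) :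
    RdContinuousFamily T (fun t => fderiv ℝ (extendedRhs L φ t)) := by
  have h := (hφ.rdContinuous_fderiv.prodMk hL.rdContinuous_fderiv).comp_continuous
    (forgetCost n m).continuous
  have hc : Continuous fun q : (Vec n × Vec m →L[ℝ] Vec n) × (Vec n × Vec m →L[ℝ] ℝ) =>
      ((ContinuousLinearMap.inl ℝ (Vec n) ℝ).comp q.1
        + (ContinuousLinearMap.inr ℝ (Vec n) ℝ).comp q.2).comp (forgetCost n m) := by
    fun_prop
  refine (h.continuous_comp hc).congr fun t ht => ?_
  ext1 w
  rw [(hasFDerivAt_extendedRhs hL hφ ht w).fderiv]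
  exact ContinuousLinearMap.ext fun v => Prod.ext (by simp) (by simp)

theorem cost_eq (hT : IsTimeScaleOn T a b) {y : ℝ → Vec n} {u : ℝ → Vec m} {F : ℝ → ℝ}
    (hF : ∀ t ∈ kappa T b, HasDeltaDeriv T F (L t (y t) (u t)) t) :
    cost T a b L y u = F b - F a := deltaIntegral_eq hT hF

theorem supNorm_le {E : Type*} [NormedAddCommGroup E] [NormedSpace ℝ E] {f : ℝ → E} {C : ℝ}
    (h : ∀ t ∈ kappa T b, ‖f t‖ ≤ C) : supNorm T b f ≤ ENNReal.ofReal C :=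
  iSup₂_le fun t ht => by
    rw [← ofReal_norm]
    exact ENNReal.ofReal_le_ofReal (h t ht)

/-- Along a weak local minimizer the linearized extended system has a nontrivial costate
annihilating the controls. -/
theorem IsWeakLocalMinimizer.exists_costate (hT : IsTimeScaleOn T a b) (hL : IsRegularData T L)
    (hφ : IsRegularData T φ) {ya yb : Option (Vec n)} {y : ℝ → Vec n} {u : ℝ → Vec m}
    (hmin : IsWeakLocalMinimizer T a b L φ ya yb y u) :
    ∃ p : ℝ → (Vec n × ℝ) →L[ℝ] ℝ, p b ≠ 0 ∧
      (∀ t ∈ kappa T b, HasDeltaDeriv T p (-(p (sigma T t)).comp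
        ((fderiv ℝ (extendedRhs L φ t) ((y t, 0), u t)).comp (ContinuousLinearMap.inl ℝ _ _))) t) ∧
      ∀ t ∈ kappa T b, ∀ w : Vec m,
        p (sigma T t) (fderiv ℝ (extendedRhs L φ t) ((y t, 0), u t) (0, w)) = 0 := by
  obtain ⟨hadm, δ, hδ, hopt⟩ := hmin
  have hu := hadm.control
  have hyc : ContinuousOn y T := hT.continuousOn_of_hasDeltaDeriv hadm.dynamics
  have hyu : RdContinuousOn T T (fun t => (y t, u t)) :=
    (rdContinuousOn_of_continuousOn hyc).prodMk hu
  set c := primitive hT ℝ ⟨fun t => L t (y t) (u t), hL.rdContinuous.comp hyu⟩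
  have hc : ∀ t ∈ T, HasDeltaDeriv T c (L t (y t) (u t)) t := fun t ht =>
    hasDeltaDeriv_primitive hT ⟨fun t => L t (y t) (u t), hL.rdContinuous.comp hyu⟩ ht
  have hca : c a = 0 := primitive_left hT _
  set z : ℝ → Vec n × ℝ := fun t => (y t, c t)
  have hz : ∀ t ∈ kappa T b, HasDeltaDeriv T z (extendedRhs L φ t (z t, u t)) t :=
    fun t ht => (hadm.dynamics t ht).prodMk (hc t ht.1)
  have hzu : RdContinuousOn T T (fun t => (z t, u t)) :=
    (rdContinuousOn_of_continuousOn (hT.continuousOn_of_hasDeltaDeriv hz)).prodMk hu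
  have hf := rdContinuousFamily_extendedRhs hL hφ
  have hf' := rdContinuousFamily_fderiv_extendedRhs hL hφ
  have hf₁ : ∀ t ∈ T, ContDiff ℝ 1 (extendedRhs L φ t) := fun t ht =>
    contDiff_extendedRhs hL hφ ht
  have hD := hf'.comp hzu
  have hDeq : ∀ t ∈ T, fderiv ℝ (extendedRhs L φ t) ((y t, 0), u t)
      = fderiv ℝ (extendedRhs L φ t) (z t, u t) := fun t ht => by
    rw [(hasFDerivAt_extendedRhs hL hφ ht _).fderiv, (hasFDerivAt_extendedRhs hL hφ ht _).fderiv]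
    rfl
  rcases controllable_or_exists_costate hT hD with ⟨R, hR⟩ | ⟨p, hp, hpd, hpu⟩
  · exfalso
    -- Closeness within `δ₁` controls the difference of the delta derivatives through the dynamics;
    -- the three norms then add up to at most `3δ/8`.
    obtain ⟨δ₁, hδ₁, hclose⟩ := hf.exists_delta hT (fun t ht => (hf₁ t ht).continuous) hzu
      (ε := δ / 8) (by positivity)
    have hev := eventually_exists_trajectory hT hf₁ hf hf' hz hu hD R hR
      (ε := min δ₁ (δ / 8)) (by positivity)
    -- The target keeps the endpoint of `y` and lowers the cost by `s`.
    have htend : Tendsto (fun s : ℝ => (y b, c b - s)) (𝓝[>] 0) (𝓝 (z b)) := by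
      have : Continuous fun s : ℝ => (y b, c b - s) := by fun_prop
      have h0 := this.tendsto 0
      rw [sub_zero] at h0
      exact h0.mono_left nhdsWithin_le_nhds
    obtain ⟨s, ⟨z', u', hu', hz', hza, hzb, hnear⟩, hs⟩ :=
      ((htend.eventually hev).and self_mem_nhdsWithin).exists
    have hs0 : 0 < s := hs
    have hy' : ∀ t ∈ T, HasDeltaDeriv T (fun r => (z' r).1) (φ t (z' t).1 (u' t)) t :=
      fun t ht => (hz' t ht).clm_comp (ContinuousLinearMap.fst ℝ (Vec n) ℝ)
    have hc' : ∀ t ∈ T, HasDeltaDeriv T (fun r => (z' r).2) (L t (z' t).1 (u' t)) t :=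
      fun t ht => (hz' t ht).clm_comp (ContinuousLinearMap.snd ℝ (Vec n) ℝ)
    have hyc' : ContinuousOn (fun r => (z' r).1) T :=
      hT.continuousOn_of_hasDeltaDeriv fun t ht => hy' t ht.1
    have hya : (z' a).1 = y a := congrArg Prod.fst hza
    have hyb : (z' b).1 = y b := congrArg Prod.fst hzb
    have hadm' : IsAdmissible T a b φ ya yb (fun r => (z' r).1) u' :=
      { state := ⟨fun t ht => ⟨_, hy' t ht.1⟩,
          ((hφ.rdContinuous.comp ((rdContinuousOn_of_continuousOn hyc').prodMk hu')).mono
            sdiff_subset).congr fun t ht => (hy' t ht.1).deltaDeriv_eq hT ht⟩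
        control := hu'
        dynamics := fun t ht => hy' t ht.1
        left := fun d hd => hya.trans (hadm.left d hd)
        right := fun d hd => hyb.trans (hadm.right d hd) }
    have hle := hopt _ u' hadm' (by
      have n1 : supNorm T b (fun t => (z' t).1 - y t) ≤ ENNReal.ofReal (δ / 8) :=
        supNorm_le fun t ht => (norm_fst_le ((z' t) - z t)).trans ((norm_fst_le
          ((z' t, u' t) - (z t, u t))).trans ((hnear t ht.1).le.trans (min_le_right _ _)))
      have n3 : supNorm T b (fun t => u' t - u t) ≤ ENNReal.ofReal (δ / 8) :=
        supNorm_le fun t ht => (norm_snd_le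
          ((z' t, u' t) - (z t, u t))).trans ((hnear t ht.1).le.trans (min_le_right _ _))
      have n2 : supNorm T b (deltaDeriv T (fun t => (z' t).1 - y t)) ≤ ENNReal.ofReal (δ / 8) :=
        supNorm_le fun t ht => by
          rw [((hy' t ht.1).sub (hadm.dynamics t ht)).deltaDeriv_eq hT ht]
          exact (norm_fst_le (extendedRhs L φ t (z' t, u' t) - extendedRhs L φ t (z t, u t))).trans
            (hclose t ht.1 _ ((hnear t ht.1).trans_le (min_le_left _ _)))
      refine (add_le_add (add_le_add n1 n2) n3).trans_lt ?_
      rw [← ENNReal.ofReal_add (by positivity) (by positivity),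
        ← ENNReal.ofReal_add (by positivity) (by positivity)]
      exact (ENNReal.ofReal_lt_ofReal_iff hδ).2 (by linarith))
    rw [cost_eq hT (fun t ht => hc t ht.1), cost_eq hT (fun t ht => hc' t ht.1), hzb, hza] at hle
    change c b - c a ≤ c b - s - c a at hle
    linarith
  · refine ⟨p, hp, fun t ht => ?_, fun t ht => ?_⟩
    · rw [hDeq t ht.1]; exact hpd t ht
    · rw [hDeq t ht.1]; exact hpu t ht

/-- The Riesz representation of functionals on `ℝ^n`, as a linear map. -/
noncomputable def riesz (n : ℕ) : (Vec n →L[ℝ] ℝ) →L[ℝ] Vec n where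
  toFun := (InnerProductSpace.toDual ℝ (Vec n)).symm
  map_add' := map_add _
  map_smul' c l := by simp
  cont := (InnerProductSpace.toDual ℝ (Vec n)).symm.continuous

theorem inner_riesz (l : Vec n →L[ℝ] ℝ) (x : Vec n) : inner ℝ (riesz n l) x = l x :=
  InnerProductSpace.toDual_symm_apply

theorem gradient_eq_riesz {g : Vec n → ℝ} {l : Vec n →L[ℝ] ℝ} {x : Vec n}
    (h : HasFDerivAt g l x) : gradient g x = riesz n l := by
  rw [gradient, h.fderiv]; rfl

/-- Along the trajectory `L*_{y^Δ} = -ψ^σ`, and the adjoint equation reads `ψ^Δ = -L*_y`. Since `ψ^σ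
= ψ + μ ψ^Δ`, the combination `L*_{y^Δ} - μ L*_y` collapses to `-ψ`, whose delta derivative is
`L*_y`. -/
theorem satisfiesEulerLagrange_of_costate (hT : IsTimeScaleOn T a b) (hL : IsRegularData T L)
    (hφ : IsRegularData T φ) {y : ℝ → Vec n} {u : ℝ → Vec m}
    (hy : ∀ t ∈ kappa T b, HasDeltaDeriv T y (φ t (y t) (u t)) t)
    {p : ℝ → (Vec n × ℝ) →L[ℝ] ℝ}
    (hpd : ∀ t ∈ kappa T b, HasDeltaDeriv T p (-(p (sigma T t)).comp
      ((fderiv ℝ (extendedRhs L φ t) ((y t, 0), u t)).comp (ContinuousLinearMap.inl ℝ _ _))) t)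
    (hpu : ∀ t ∈ kappa T b, ∀ w : Vec m,
      p (sigma T t) (fderiv ℝ (extendedRhs L φ t) ((y t, 0), u t) (0, w)) = 0)
    {ψ : ℝ → Vec n} (hψ : ψ = fun t => riesz n ((p t).comp (ContinuousLinearMap.inl ℝ _ _)))
    {ψ₀ : ℝ} (hψ₀ : ∀ t ∈ T, p t (0, 1) = ψ₀) :
    (∀ t ∈ kappa T b, DeltaDifferentiableAt T ψ t) ∧
      SatisfiesEulerLagrange (augmented L φ ψ₀) T b y u ψ := by
  have hσ : ∀ t ∈ T, sigma T t ∈ T := fun t ht => hT.sigma_mem (hT.isGreatest.2 ht)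
  have hsplit : ∀ t ∈ T, ∀ (x : Vec n) (r : ℝ), p t (x, r) = ψ₀ * r + inner ℝ (ψ t) x := by
    intro t ht x r
    have e : ((x, r) : Vec n × ℝ) = (x, 0) + r • (0, 1) := by simp
    rw [e, map_add, map_smul, hψ₀ t ht, hψ, inner_riesz, smul_eq_mul, add_comm, mul_comm]
    rfl
  have haug : ∀ t ∈ T, ∀ (x : Vec n) (w : Vec m) (v : Vec n),
      augmented L φ ψ₀ t x w (ψ (sigma T t)) v
        = p (sigma T t) (extendedRhs L φ t ((x, 0), w)) - inner ℝ (ψ (sigma T t)) v := by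
    intro t ht x w v
    rw [extendedRhs, hsplit _ (hσ t ht), augmented, inner_sub_right, add_sub_assoc]
  have hf : ∀ t ∈ T, HasFDerivAt (extendedRhs L φ t)
      (fderiv ℝ (extendedRhs L φ t) ((y t, 0), u t)) ((y t, 0), u t) := fun t ht =>
    ((contDiff_extendedRhs hL hφ ht).differentiable one_ne_zero _).hasFDerivAt
  have hpartialY : ∀ t ∈ T, partialY (augmented L φ ψ₀) T y u ψ t
      = riesz n (((p (sigma T t)).comp ((fderiv ℝ (extendedRhs L φ t) ((y t, 0), u t)).comp
        (ContinuousLinearMap.inl ℝ _ _))).comp (ContinuousLinearMap.inl ℝ _ _)) := by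
    intro t ht
    refine gradient_eq_riesz ?_
    simp only [haug t ht]
    have h1 : HasFDerivAt (fun x : Vec n => ((x, (0 : ℝ)), u t))
        ((ContinuousLinearMap.inl ℝ (Vec n × ℝ) (Vec m)).comp
          (ContinuousLinearMap.inl ℝ (Vec n) ℝ)) (y t) := by
      exact (hasFDerivAt_prodMk_left (𝕜 := ℝ) (y t, (0 : ℝ)) (u t)).comp (y t)
        (hasFDerivAt_prodMk_left (𝕜 := ℝ) (y t) (0 : ℝ))
    have h2 : HasFDerivAt (fun x => extendedRhs L φ t ((x, 0), u t)) _ (y t) :=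
      HasFDerivAt.comp (g := extendedRhs L φ t) (y t) (hf t ht) h1
    exact ((p (sigma T t)).hasFDerivAt.comp (y t) h2).sub_const _
  have hpartialU : ∀ t ∈ kappa T b, partialU (augmented L φ ψ₀) T y u ψ t = 0 := by
    intro t ht
    rw [← map_zero (riesz m)]
    refine gradient_eq_riesz ?_
    simp only [haug t ht.1]
    have h1 : HasFDerivAt (fun w => extendedRhs L φ t ((y t, 0), w)) _ (u t) :=
      HasFDerivAt.comp (g := extendedRhs L φ t) (u t) (hf t ht.1)
        (hasFDerivAt_prodMk_right (𝕜 := ℝ) (y t, (0 : ℝ)) (u t))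
    have h2 := ((p (sigma T t)).hasFDerivAt.comp (u t) h1).sub_const
      (inner ℝ (ψ (sigma T t)) (deltaDeriv T y t))
    have e : (p (sigma T t)).comp ((fderiv ℝ (extendedRhs L φ t) ((y t, 0), u t)).comp
        (ContinuousLinearMap.inr ℝ (Vec n × ℝ) (Vec m))) = 0 :=
      ContinuousLinearMap.ext fun w => hpu t ht w
    rw [e] at h2
    exact h2
  have hpartialYDelta : ∀ t ∈ T, partialYDelta (augmented L φ ψ₀) T y u ψ t
      = -ψ (sigma T t) := by
    intro t ht
    refine (gradient_eq_riesz (l := -(innerSL ℝ (ψ (sigma T t)))) ?_).trans ?_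
    · simp only [haug t ht]
      exact (innerSL ℝ (ψ (sigma T t))).hasFDerivAt.const_sub _
    · refine ext_inner_right ℝ fun x => ?_
      rw [inner_riesz, inner_neg_left]
      rfl
  have hψd : ∀ t ∈ kappa T b,
      HasDeltaDeriv T ψ (-partialY (augmented L φ ψ₀) T y u ψ t) t := by
    intro t ht
    have h1 := ((hpd t ht).clm_comp ((ContinuousLinearMap.compL ℝ (Vec n) (Vec n × ℝ) ℝ).flip
      (ContinuousLinearMap.inl ℝ (Vec n) ℝ))).clm_comp (riesz n)
    rw [hpartialY t ht.1, hψ, ← map_neg, ← ContinuousLinearMap.neg_comp]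
    exact h1
  have hmem : ∀ t ∈ T, t ∉ kappa T b → t = b := fun t ht hk => by
    by_contra hne
    exact hk (mem_kappa_of_lt ht (lt_of_le_of_ne (hT.isGreatest.2 ht) hne))
  have hmu : mu T b = 0 := sub_eq_zero.2 hT.sigma_right
  refine ⟨fun t ht => ⟨_, hψd t ht⟩, ⟨fun t ht => ?_, fun t ht => ?_, hpartialU, fun t ht => ?_⟩⟩
  · have h1 := (hψd t ht).neg
    rw [neg_neg] at h1
    refine h1.congr (fun s hs => ?_) (hσ t ht.1)
    rw [hpartialYDelta s hs]
    -- A left-scattered `b` is treated apart: there `μ = 0` and `σ(b) = b`, so the expression is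
    -- `-ψ(b)` without any derivative of `ψ`.
    by_cases hk : s ∈ kappa T b
    · rw [(hψd s hk).apply_sigma hs, smul_neg]
      abel
    · rw [hmem s hs hk, hmu, hT.sigma_right, zero_smul, sub_zero]
  · rw [hpartialU t ht]
    refine (hasDeltaDeriv_const 0).congr (fun s hs => ?_) (hσ t ht.1)
    by_cases hk : s ∈ kappa T b
    · rw [hpartialU s hk, smul_zero, neg_zero]
    · rw [hmem s hs hk, hmu, zero_smul, neg_zero]
  · rw [partialPsi, (hy t ht).deltaDeriv_eq hT ht]
    simp only [augmented, sub_self, inner_zero_right]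
    exact gradient_fun_const _ _

end Lagrange

end TimeScale

/-- Lagrange multiplier rule on time scales. -/
theorem corollary3p3 {n m : ℕ} (T : Set ℝ) (a b : ℝ) (hT : TimeScale.IsTimeScaleOn T a b)
    (L : ℝ → TimeScale.Vec n → TimeScale.Vec m → ℝ)
    (φ : ℝ → TimeScale.Vec n → TimeScale.Vec m → TimeScale.Vec n)
    (hL : TimeScale.IsRegularData T L) (hφ : TimeScale.IsRegularData T φ)
    (ya yb : Option (TimeScale.Vec n))
    (ystar : ℝ → TimeScale.Vec n) (ustar : ℝ → TimeScale.Vec m)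
    (hmin : TimeScale.IsWeakLocalMinimizer T a b L φ ya yb ystar ustar) :
    ∃ (ψ₀ : ℝ) (ψ : ℝ → TimeScale.Vec n),
      0 ≤ ψ₀ ∧
      (∀ t ∈ TimeScale.kappa T b, TimeScale.DeltaDifferentiableAt T ψ t) ∧
      (ψ₀ ≠ 0 ∨ ∃ t ∈ TimeScale.kappa T b, ψ (TimeScale.sigma T t) ≠ 0) ∧
      TimeScale.SatisfiesEulerLagrange (TimeScale.augmented L φ ψ₀) T b ystar ustar ψ := by
  open TimeScale in
  obtain ⟨p, hpb, hpd, hpu, hp0⟩ : ∃ p : ℝ → (Vec n × ℝ) →L[ℝ] ℝ, p b ≠ 0 ∧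
      (∀ t ∈ kappa T b, HasDeltaDeriv T p (-(p (sigma T t)).comp
        ((fderiv ℝ (extendedRhs L φ t) ((ystar t, 0), ustar t)).comp
          (ContinuousLinearMap.inl ℝ _ _))) t) ∧
      (∀ t ∈ kappa T b, ∀ w : Vec m,
        p (sigma T t) (fderiv ℝ (extendedRhs L φ t) ((ystar t, 0), ustar t) (0, w)) = 0) ∧
      0 ≤ p a (0, 1) := by
    obtain ⟨p, hpb, hpd, hpu⟩ := hmin.exists_costate hT hL hφ
    -- The conditions on `p` are invariant under `p ↦ -p`, so the sign of the cost component can be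
    -- chosen.
    rcases le_total 0 (p a (0, 1)) with h | h
    · exact ⟨p, hpb, hpd, hpu, h⟩
    · refine ⟨fun t => -p t, neg_ne_zero.2 hpb, fun t ht => ?_, fun t ht w => ?_, ?_⟩
      · exact (hpd t ht).neg
      · exact neg_eq_zero.2 (hpu t ht w)
      · exact neg_nonneg.2 h
  have hconst : ∀ t ∈ T, p t (0, 1) = p a (0, 1) := by
    refine hT.eq_left_of_hasDeltaDeriv_zero (f := fun t => p t (0, 1)) fun t ht => ?_
    have h := (hpd t ht).clm_comp
      (ContinuousLinearMap.apply ℝ ℝ ((0, 1) : TimeScale.Vec n × ℝ))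
    have e : fderiv ℝ (TimeScale.extendedRhs L φ t) ((ystar t, 0), ustar t) ((0, 1), 0) = 0 := by
      rw [(TimeScale.hasFDerivAt_extendedRhs hL hφ ht.1 _).fderiv]
      exact Prod.ext (map_zero (fderiv ℝ _ _)) (map_zero (fderiv ℝ _ _))
    have e' : (ContinuousLinearMap.apply ℝ ℝ ((0, 1) : TimeScale.Vec n × ℝ))
        (-(p (TimeScale.sigma T t)).comp ((fderiv ℝ (TimeScale.extendedRhs L φ t)
          ((ystar t, 0), ustar t)).comp (ContinuousLinearMap.inl ℝ _ _))) = 0 := by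
      change -(p (TimeScale.sigma T t)) (fderiv ℝ (TimeScale.extendedRhs L φ t)
        ((ystar t, 0), ustar t) ((0, 1), 0)) = 0
      rw [e, map_zero, neg_zero]
    rw [e'] at h
    exact h
  obtain ⟨h1, h2⟩ := TimeScale.satisfiesEulerLagrange_of_costate hT hL hφ hmin.1.dynamics hpd hpu
    rfl hconst
  refine ⟨p a (0, 1), _, hp0, h1, ?_, h2⟩
  -- If both multipliers vanished, a point with `σ(t) = b` would make both components of `p(b)`
  -- zero.
  by_contra! hcon
  obtain ⟨h3, h4⟩ := hcon
  obtain ⟨t, ht, htb⟩ := hT.exists_sigma_eq_right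
  have h5 := h4 t ht
  rw [htb] at h5
  refine hpb (ContinuousLinearMap.ext fun x => ?_)
  have e : x = (x.1, 0) + x.2 • (0, 1) := by ext <;> simp
  have h6 : p b (x.1, 0) = 0 := by
    have := TimeScale.inner_riesz ((p b).comp (ContinuousLinearMap.inl ℝ _ _)) x.1
    rw [h5, inner_zero_left] at this
    exact this.symm
  rw [e, map_add, map_smul, hconst b hT.right_mem, h3, smul_zero, h6, add_zero]
  rfl
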